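/- Fix a finite alphabet $\Sigma$. A transducer $T$ over $\Sigma$ has a finite nonempty set of states, sets of initial and of final states, and a finite set of transitions $(p,x/y,q)$ with $x,y\in\Sigma\cup\{\varepsilon\}$; $T(u)$ is the set of words $v$ such that $(u,v)$ is the label of a path from an initial to a final state. An automaton $A$ is a nondeterministic finite automaton over $\Sigma$ (without $\varepsilon$-transitions, with at least one state), and $L(A)$ is its language. The size $|T|$, resp. $|A|$, is the number of states plus the number of transitions. Let $T{\downarrow}A{\uparrow}A$ be the product transducer, with states $(p,r,s)$ for states $p$ of $T$ and $r,s$ of $A$, that simulates $T$ while running $A$ on the input and on the output; its initial (final) states are those all of whose components are initial (final). So it realizes $\{(u,v) : v\in T(u),\ u,v\in L(A)\}$. Let $S$ be its trim part, obtained by removing every state that is not reachable from an initial state or cannot reach a final state. Then: (1) $T(u)\cap L(A)$ is finite for every $u\in L(A)$ if and only if $S$ has no cycle all of whose transitions have input label $\varepsilon$ and at least one of whose transitions has an output label different from $\varepsilon$. (2) There is an algorithm (a program of a unit-cost random access machine whose words have $O(\log(|T|+|A|))$ bits) that, given $T$ and $A$ (states numbered, transitions listed in any order), decides in time $O(|T|\,|A|^2)$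 whether $T(u)\cap L(A)$ is finite for every $u\in L(A)$. The program and the constants depend only on $\Sigma$. -/

import Mathlib

/-! ### Transducers and the restriction operations -/

/-- A transducer in standard form with input and output alphabet `α` and state set `Q`.
A transition `(p, x, y, q)` goes from `p` to `q`, reads `x` and writes `y`, where `none` is the
empty word and `some a` is the symbol `a`. -/
structure Transducer (α Q : Type*) where
  /-- the transitions `(p, x/y, q)` -/
  edges : Set (Q × Option α × Option α × Q)
  /-- the initial states -/
  start : Set Q
  /-- the final states -/
  accept : Set Q

namespace Transducer

variable {α Q S : Type*}

/-- `T.Path p u v q`: there is a path in `T` from `p` to `q` with label `(u, v)`. -/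
inductive Path (T : Transducer α Q) : Q → List α → List α → Q → Prop
  | nil (q : Q) : Path T q [] [] q
  | cons {p q r : Q} {x y : Option α} {u v : List α} :
      (p, x, y, q) ∈ T.edges → Path T q u v r → Path T p (x.toList ++ u) (y.toList ++ v) r

/-- The set `T(u)` of outputs of `T` on input `u`. -/
def outputs (T : Transducer α Q) (u : List α) : Set (List α) :=
  {v | ∃ p ∈ T.start, ∃ q ∈ T.accept, T.Path p u v q}

/-- The size of a transducer: the number of states plus the number of transitions. -/
noncomputable def size (T : Transducer α Q) : ℕ := Nat.card Q + T.edges.ncard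

/-- The language `L` belongs to the finitely marginal property described by `T`:
`T(u) ∩ L` is finite for every `u ∈ L`. -/
def FinMarginal (T : Transducer α Q) (L : Language α) : Prop :=
  ∀ u ∈ L, {v | v ∈ T.outputs u ∧ v ∈ L}.Finite

/-- A state is useful if it is reachable from an initial state and can reach a final state. -/
def Useful (T : Transducer α Q) (q : Q) : Prop :=
  (∃ p ∈ T.start, ∃ u v, T.Path p u v q) ∧ (∃ r ∈ T.accept, ∃ u v, T.Path q u v r)

/-- The trim part of `T`: all states that are not useful are removed. -/
def trim (T : Transducer α Q) : Transducer α {q : Q // T.Useful q} where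
  edges := {e | (e.1.val, e.2.1, e.2.2.1, e.2.2.2.val) ∈ T.edges}
  start := {q | q.val ∈ T.start}
  accept := {q | q.val ∈ T.accept}

/-- `T` has a proper ε-input cycle: a closed path all of whose transitions have the empty word as
input label, and not all of them the empty word as output label. As the label of a path is the
concatenation of the labels of its transitions, its label is `(ε, v)` with `v` not empty. -/
def HasProperEpsCycle (T : Transducer α Q) : Prop :=
  ∃ (q : Q) (v : List α), v ≠ [] ∧ T.Path q [] v q

end Transducer

/-- The move of an automaton on a transition label: on a symbol it makes a transition, on the
empty word it stays where it is. -/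
def NFA.OptStep {α S : Type*} (A : NFA α S) (s : S) : Option α → S → Prop
  | none, t => t = s
  | some a, t => t ∈ A.step s a

/-- The transitions `(p, a, q)` of an automaton. -/
def NFA.transitions {α S : Type*} (A : NFA α S) : Set (S × α × S) :=
  {e | e.2.2 ∈ A.step e.1 e.2.1}

/-- The size of an automaton: the number of states plus the number of transitions. -/
noncomputable def NFA.size {α S : Type*} (A : NFA α S) : ℕ := Nat.card S + A.transitions.ncard

namespace Transducer

variable {α Q S : Type*}

/-- The transducer `T ↓ A` (product construction): `T` restricted to inputs in `L(A)`. -/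
def restrictInput (T : Transducer α Q) (A : NFA α S) : Transducer α (Q × S) where
  edges := {e | (e.1.1, e.2.1, e.2.2.1, e.2.2.2.1) ∈ T.edges ∧ A.OptStep e.1.2 e.2.1 e.2.2.2.2}
  start := {q | q.1 ∈ T.start ∧ q.2 ∈ A.start}
  accept := {q | q.1 ∈ T.accept ∧ q.2 ∈ A.accept}

/-- The transducer `T ↑ A` (product construction): `T` restricted to outputs in `L(A)`. -/
def restrictOutput (T : Transducer α Q) (A : NFA α S) : Transducer α (Q × S) where
  edges := {e | (e.1.1, e.2.1, e.2.2.1, e.2.2.2.1) ∈ T.edges ∧ A.OptStep e.1.2 e.2.2.1 e.2.2.2.2}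
  start := {q | q.1 ∈ T.start ∧ q.2 ∈ A.start}
  accept := {q | q.1 ∈ T.accept ∧ q.2 ∈ A.accept}

end Transducer

/-! ### Random access machines with step count

The usual unit-cost random access machine with bounded words, in the form of structured programs:
finitely many registers and finitely many arrays, all holding natural numbers. Each elementary
instruction and each test costs one step. A program is executed with a word bound `B`: an
instruction that would create a number that is not smaller than `B` has no execution. -/

namespace RAM

/-- Programs. Registers and arrays are named by numbers. -/
inductive Cmd : Type
  /-- no operation -/
  | skip : Cmd
  /-- `reg r := c` for a constant `c` -/
  | const (r c : ℕ) : Cmd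
  /-- `reg r := reg i` -/
  | move (r i : ℕ) : Cmd
  /-- `reg r := reg i + reg j` -/
  | add (r i j : ℕ) : Cmd
  /-- `reg r := reg i - reg j` (truncated at zero) -/
  | sub (r i j : ℕ) : Cmd
  /-- `reg r := reg i * reg j` -/
  | mul (r i j : ℕ) : Cmd
  /-- `reg r := arr a [reg i]` -/
  | load (r a i : ℕ) : Cmd
  /-- `arr a [reg i] := reg j` -/
  | store (a i j : ℕ) : Cmd
  /-- first one program, then the other -/
  | seq (P₁ P₂ : Cmd) : Cmd
  /-- the first program if `reg r ≠ 0`, the second otherwise -/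
  | ite (r : ℕ) (P₁ P₂ : Cmd) : Cmd
  /-- repeat the program as long as `reg r ≠ 0` -/
  | loop (r : ℕ) (P : Cmd) : Cmd

/-- A state of the memory: the contents of the registers and of the array cells. -/
structure State where
  /-- `reg r` is the content of register `r` -/
  reg : ℕ → ℕ
  /-- `arr a i` is the content of cell `i` of array `a` -/
  arr : ℕ → ℕ → ℕ

/-- Write `v` into register `r`. -/
def State.setReg (s : State) (r v : ℕ) : State :=
  { s with reg := Function.update s.reg r v }

/-- Write `v` into cell `i` of array `a`. -/
def State.setArr (s : State) (a i v : ℕ) : State :=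
  { s with arr := Function.update s.arr a (Function.update (s.arr a) i v) }

/-- `Exec B P s t s'`: with word bound `B`, the program `P`, started in `s`, halts after exactly
`t` steps in `s'`. (Constants, sums and products are the only source of new large numbers, so they
are the only place where the word bound has to be checked.) -/
inductive Exec (B : ℕ) : Cmd → State → ℕ → State → Prop
  | skip (s : State) : Exec B .skip s 1 s
  | const (s : State) (r c : ℕ) (h : c < B) : Exec B (.const r c) s 1 (s.setReg r c)
  | move (s : State) (r i : ℕ) : Exec B (.move r i) s 1 (s.setReg r (s.reg i))
  | add (s : State) (r i j : ℕ) (h : s.reg i + s.reg j < B) :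
      Exec B (.add r i j) s 1 (s.setReg r (s.reg i + s.reg j))
  | sub (s : State) (r i j : ℕ) : Exec B (.sub r i j) s 1 (s.setReg r (s.reg i - s.reg j))
  | mul (s : State) (r i j : ℕ) (h : s.reg i * s.reg j < B) :
      Exec B (.mul r i j) s 1 (s.setReg r (s.reg i * s.reg j))
  | load (s : State) (r a i : ℕ) :
      Exec B (.load r a i) s 1 (s.setReg r (s.arr a (s.reg i)))
  | store (s : State) (a i j : ℕ) :
      Exec B (.store a i j) s 1 (s.setArr a (s.reg i) (s.reg j))
  | seq {P₁ P₂ : Cmd} {s s₁ s₂ : State} {t₁ t₂ : ℕ} :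
      Exec B P₁ s t₁ s₁ → Exec B P₂ s₁ t₂ s₂ → Exec B (.seq P₁ P₂) s (t₁ + t₂) s₂
  | ite_pos {r : ℕ} {P₁ P₂ : Cmd} {s s₁ : State} {t : ℕ} :
      s.reg r ≠ 0 → Exec B P₁ s t s₁ → Exec B (.ite r P₁ P₂) s (t + 1) s₁
  | ite_neg {r : ℕ} {P₁ P₂ : Cmd} {s s₁ : State} {t : ℕ} :
      s.reg r = 0 → Exec B P₂ s t s₁ → Exec B (.ite r P₁ P₂) s (t + 1) s₁
  | loop_exit {r : ℕ} {P : Cmd} {s : State} : s.reg r = 0 → Exec B (.loop r P) s 1 s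
  | loop_step {r : ℕ} {P : Cmd} {s s₁ s₂ : State} {t₁ t₂ : ℕ} :
      s.reg r ≠ 0 → Exec B P s t₁ s₁ → Exec B (.loop r P) s₁ t₂ s₂ →
        Exec B (.loop r P) s (t₁ + t₂ + 1) s₂

/-- The initial state on input `w`: array `0` holds `w` in its first cells, and all other cells and
all registers are zero. -/
def initial (w : List ℕ) : State where
  reg := fun _ => 0
  arr := fun a i => if a = 0 then w.getD i 0 else 0

end RAM

/-! ### Transducers and automata as inputs of a machine -/

/-- The number for a transition label: `0` for the empty word, `a + 1` for the symbol `a`. -/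
def labelCode {σ : ℕ} : Option (Fin σ) → ℕ
  | none => 0
  | some a => a.val + 1

open Classical in
/-- The characteristic vector of a set of states. -/
noncomputable def flags {n : ℕ} (s : Set (Fin n)) : List ℕ :=
  (List.finRange n).map fun q => if q ∈ s then 1 else 0

/-- `l` lists the elements of `s` in some order, each of them once. -/
def IsListing {β : Type*} (l : List β) (s : Set β) : Prop := l.Nodup ∧ ∀ e, e ∈ l ↔ e ∈ s

/-- The input word for a transducer whose transitions are given as the list `l`: number of states,
number of transitions, initial states, final states, and the transitions one after the other. -/
noncomputable def Transducer.code {σ n : ℕ} (T : Transducer (Fin σ) (Fin n))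
    (l : List (Fin n × Option (Fin σ) × Option (Fin σ) × Fin n)) : List ℕ :=
  [n, l.length] ++ flags T.start ++ flags T.accept ++
    l.flatMap fun e => [e.1.val, labelCode e.2.1, labelCode e.2.2.1, e.2.2.2.val]

/-- The input word for an automaton whose transitions are given as the list `l`: number of states,
number of transitions, initial states, final states, and the transitions one after the other. -/
noncomputable def NFA.code {σ n : ℕ} (A : NFA (Fin σ) (Fin n))
    (l : List (Fin n × Fin σ × Fin n)) : List ℕ :=
  [n, l.length] ++ flags A.start ++ flags A.accept ++
    l.flatMap fun e => [e.1.val, e.2.1.val + 1, e.2.2.val]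

open Classical in
/-- The program `P` decides `T.FinMarginal L(A)` for all transducers `T` and all automata `A` over
the alphabet `Fin σ` with at least one state, with answer `1` (yes) or `0` (no) in register `0`,
within `C * (|T| * |A| ^ 2)` steps and with words of `C * log (|T| + |A|)` bits; the transitions
may be listed in any order. -/
def DecidesFinMarginal (σ : ℕ) (P : RAM.Cmd) (C : ℕ) : Prop :=
  ∀ (m n : ℕ), 0 < m → 0 < n →
  ∀ (T : Transducer (Fin σ) (Fin m)) (A : NFA (Fin σ) (Fin n))
    (l : List (Fin m × Option (Fin σ) × Option (Fin σ) × Fin m))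
    (k : List (Fin n × Fin σ × Fin n)),
    IsListing l T.edges → IsListing k A.transitions →
    ∃ (t : ℕ) (s : RAM.State),
      RAM.Exec ((T.size + A.size) ^ C) P (RAM.initial (T.code l ++ A.code k)) t s ∧
      t ≤ C * (T.size * A.size ^ 2) ∧
      s.reg 0 = if T.FinMarginal A.accepts then 1 else 0

/-!
Both parts rest on the product transducer `T ↓ A ↑ A`, whose outputs on `u` are the words of
`T(u) ∩ L(A)` if `u ∈ L(A)`, and which has no outputs on other words.

For the first part, a proper cycle with empty input through a useful state can be repeated and so
gives infinitely many outputs for one input. Conversely, look at the states in which an accepting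
path writes its symbols, each together with the length of the remaining input. If the output is
longer than the number of such pairs, a pair occurs twice, and the path between its occurrences
reads nothing and writes something (`Transducer.forall_finite_outputs_iff`).

For the second part, the trim part has a proper cycle with empty input iff some product transition
with empty input and nonempty output starts at a useful state and has both ends in the same strongly
connected component of the graph of the transitions with empty input
(`Transducer.trim_hasProperEpsCycle_iff`). The program lists the product graph explicitly. The
moves of `A` are its transitions together with one move on the empty word for each state, so there
are exactly `|A|` of them, and each triple of a transition of `T`, a move on the input and a move on
the output gives one edge; triples with labels that do not match give a loop at a dummy node `0`.
Thus the edges can be numbered uniformly, and their number is at most `|T| |A|²`. In the graph of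
the transitions with empty input, every other edge is replaced by a loop at its source, which
changes neither reachability nor the numbering. Then four depth-first searches follow, all by the
same verified program `RAM.search`: from the initial nodes, backwards from the final nodes, and the
two searches of Kosaraju's algorithm (`DFS.Result.kosaraju`). A last loop over the edges gives the
answer.

The invariant of depth-first search (`DFS.Inv`) is about configurations with lists for the stack and
for the finished nodes. Its key clauses say that a finished node that still reaches the stack is
strongly connected with a node on the stack, and therefore that every strongly connected component
is represented in the list of finished nodes no earlier than any node that it reaches.
Time is counted with a potential: roots, unexamined edges and unfinished nodes that are left. As the
arrays of the machine are zero at the start and each search gets its own block of arrays, nothing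
has to be cleared.
-/

/-! ### Paths of transducers -/

namespace Transducer

variable {α Q S : Type*} {T : Transducer α Q}

theorem Path.append {p q r : Q} {u v u' v' : List α} (h : T.Path p u v q)
    (h' : T.Path q u' v' r) : T.Path p (u ++ u') (v ++ v') r := by
  induction h with
  | nil q => simpa using h'
  | cons he _ ih => simpa [List.append_assoc] using Path.cons he (ih h')

theorem Path.single {p q : Q} {x y : Option α} (h : (p, x, y, q) ∈ T.edges) :
    T.Path p x.toList y.toList q := by
  simpa using Path.cons h (Path.nil q)

/-- Repeating a closed path. -/
theorem Path.pump {q : Q} {v : List α} (h : T.Path q [] v q) (k : ℕ) :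
    T.Path q [] (List.replicate k v).flatten q := by
  induction k with
  | zero => simpa using Path.nil q
  | succ k ih => simpa [List.replicate_succ] using h.append ih

theorem Path.of_trim {p q : {q : Q // T.Useful q}} {u v : List α} (h : T.trim.Path p u v q) :
    T.Path p.1 u v q.1 := by
  induction h with
  | nil q => exact Path.nil _
  | cons he _ ih => exact Path.cons he ih

/-- A path between useful states runs through useful states only. -/
theorem Path.to_trim {p q : Q} {u v : List α} (h : T.Path p u v q) (hp : T.Useful p)
    (hq : T.Useful q) : T.trim.Path ⟨p, hp⟩ u v ⟨q, hq⟩ := by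
  induction h with
  | nil q => exact Path.nil _
  | @cons p q r x y u v he h ih =>
    have hu : T.Useful q := by
      obtain ⟨⟨i, hi, u₁, v₁, h₁⟩, -⟩ := hp
      obtain ⟨-, f, hf, u₂, v₂, h₂⟩ := hq
      exact ⟨⟨i, hi, _, _, h₁.append (Path.single he)⟩, f, hf, _, _, h.append h₂⟩
    exact Path.cons (T := T.trim) (q := ⟨q, hu⟩) he (ih hu hq)

/-- The states that a path visits just before it writes a symbol, each together with the length
of the input that is still to be read. Between any two of them the path writes something. -/
theorem Path.exists_checkpoints {p q : Q} {u v : List α} (h : T.Path p u v q) :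
    ∃ l : List (Q × ℕ), l.length = v.length ∧
      (∀ b ∈ l, b.2 ≤ u.length ∧ (∃ u' v', u'.length + b.2 = u.length ∧ T.Path p u' v' b.1) ∧
        ∃ u' v', T.Path b.1 u' v' q) ∧
      l.Pairwise fun a b => ∃ u' v', v' ≠ [] ∧ u'.length + b.2 = a.2 ∧ T.Path a.1 u' v' b.1 := by
  induction h with
  | nil q => exact ⟨[], by simp⟩
  | @cons p q r x y u v he h ih =>
    obtain ⟨l, hl, hb, hp⟩ := ih
    have key : ∀ b ∈ l, b.2 ≤ (x.toList ++ u).length ∧ (∃ u' v', u'.length + b.2 =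
        (x.toList ++ u).length ∧ T.Path p u' (y.toList ++ v') b.1) ∧
        ∃ u' v', T.Path b.1 u' v' r := by
      intro b hbl
      obtain ⟨h1, ⟨u', v', h2, h3⟩, h4⟩ := hb b hbl
      refine ⟨by simp; omega, ⟨x.toList ++ u', v', by simp; omega, Path.cons he h3⟩, h4⟩
    cases y with
    | none =>
      refine ⟨l, by simpa using hl, fun b hbl => ?_, hp⟩
      obtain ⟨h1, ⟨u', v', h2, h3⟩, h4⟩ := key b hbl
      exact ⟨h1, ⟨u', _, h2, h3⟩, h4⟩
    | some y =>
      refine ⟨(p, (x.toList ++ u).length) :: l, by simp [hl], ?_, List.pairwise_cons.2 ⟨?_, hp⟩⟩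
      · intro b hbl
        rcases List.mem_cons.1 hbl with rfl | hbl
        · exact ⟨le_rfl, ⟨[], [], by simp, Path.nil _⟩, _, _, Path.cons he h⟩
        · obtain ⟨h1, ⟨u', v', h2, h3⟩, h4⟩ := key b hbl
          exact ⟨h1, ⟨u', _, h2, h3⟩, h4⟩
      · intro b hbl
        obtain ⟨-, ⟨u', v', h2, h3⟩, -⟩ := key b hbl
        exact ⟨u', _, by simp, h2, h3⟩

/-- If the trim part has no proper cycle with empty input, the length of the outputs is bounded:
otherwise two checkpoints of an accepting path agree, and the path between them is such a cycle. -/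
theorem length_le_of_not_hasProperEpsCycle [Finite Q] (hT : ¬ T.trim.HasProperEpsCycle)
    {u v : List α} (hv : v ∈ T.outputs u) : v.length ≤ Nat.card (Q × Fin (u.length + 1)) := by
  obtain ⟨p, hp, q, hq, h⟩ := hv
  obtain ⟨l, hl, hb, hpw⟩ := h.exists_checkpoints
  have hnd : l.Nodup := by
    refine List.Pairwise.imp_of_mem (fun {a b} ha hb' => ?_) hpw
    rintro ⟨u', v', hv', hu', hpath⟩ rfl
    obtain rfl : u' = [] := List.length_eq_zero_iff.1 (by omega)
    obtain ⟨-, ⟨u₁, v₁, -, h₁⟩, u₂, v₂, h₂⟩ := hb a ha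
    have hus : T.Useful a.1 := ⟨⟨p, hp, _, _, h₁⟩, q, hq, _, _, h₂⟩
    exact hT ⟨⟨a.1, hus⟩, v', hv', hpath.to_trim hus hus⟩
  have := Fintype.ofFinite Q
  classical
  rw [← hl, ← List.toFinset_card_of_nodup hnd, Nat.card_eq_fintype_card]
  refine Finset.card_le_card_of_injOn (fun b => (b.1, Fin.ofNat (u.length + 1) b.2))
    (fun _ _ => Finset.mem_coe.2 (Finset.mem_univ _)) ?_
  intro a ha b hb' hab
  have h1 := (hb a (by simpa using ha)).1
  have h2 := (hb b (by simpa using hb')).1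
  simp only [Prod.mk.injEq, Fin.ext_iff, Fin.val_ofNat, Nat.mod_eq_of_lt (Nat.lt_succ_of_le h1),
    Nat.mod_eq_of_lt (Nat.lt_succ_of_le h2)] at hab
  exact Prod.ext hab.1 hab.2

/-- A transducer with finitely many states and letters has an infinite set of outputs for some
input iff its trim part has a proper cycle with empty input. -/
theorem forall_finite_outputs_iff [Finite Q] [Finite α] :
    (∀ u, (T.outputs u).Finite) ↔ ¬ T.trim.HasProperEpsCycle := by
  constructor
  · rintro hfin ⟨⟨q, ⟨p, hp, u₁, v₁, h₁⟩, r, hr, u₂, v₂, h₂⟩, v, hv, hc⟩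
    refine Set.infinite_of_injective_forall_mem (f := fun k : ℕ =>
      v₁ ++ ((List.replicate k v).flatten ++ v₂)) ?_ ?_ (hfin (u₁ ++ u₂))
    · intro k k' hk
      have := congrArg List.length hk
      have hpos : 0 < v.length := List.length_pos_iff.2 hv
      simpa [hpos.ne'] using this
    · intro k
      exact ⟨p, hp, r, hr, h₁.append ((hc.of_trim.pump k).append h₂)⟩
  · intro h u
    exact (List.finite_length_le α _).subset fun v hv => length_le_of_not_hasProperEpsCycle h hv

/-! ### The product with an automaton -/

/-- Transitions with empty input, as a relation on states. -/
def EpsStep (T : Transducer α Q) (p q : Q) : Prop := ∃ y, (p, none, y, q) ∈ T.edges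

/-- Transitions with any label, as a relation on states. -/
def Step (T : Transducer α Q) (p q : Q) : Prop := ∃ x y, (p, x, y, q) ∈ T.edges

theorem exists_path_iff {p q : Q} :
    (∃ u v, T.Path p u v q) ↔ Relation.ReflTransGen T.Step p q := by
  constructor
  · rintro ⟨u, v, h⟩
    induction h with
    | nil q => exact .refl
    | cons he _ ih => exact .head ⟨_, _, he⟩ ih
  · intro h
    induction h using Relation.ReflTransGen.head_induction_on with
    | refl => exact ⟨_, _, Path.nil _⟩
    | head h _ ih =>
      obtain ⟨x, y, he⟩ := h
      obtain ⟨u, v, h⟩ := ih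
      exact ⟨_, _, Path.cons he h⟩

theorem exists_path_of_eps {p q : Q} (h : Relation.ReflTransGen T.EpsStep p q) :
    ∃ v, T.Path p [] v q := by
  induction h using Relation.ReflTransGen.head_induction_on with
  | refl => exact ⟨_, Path.nil _⟩
  | head h _ ih =>
    obtain ⟨y, he⟩ := h
    obtain ⟨v, h⟩ := ih
    exact ⟨_, Path.cons he h⟩

theorem Path.eps {p q : Q} {u v : List α} (h : T.Path p u v q) (hu : u = []) :
    Relation.ReflTransGen T.EpsStep p q := by
  induction h with
  | nil q => exact .refl
  | @cons p q r x y u v he _ ih =>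
    cases x with
    | none => exact .head ⟨_, he⟩ (ih (by simpa using hu))
    | some x => simp at hu

theorem Path.exists_proper {p q : Q} {u v : List α} (h : T.Path p u v q) (hu : u = [])
    (hv : v ≠ []) : ∃ a b y, (a, none, some y, b) ∈ T.edges ∧
      Relation.ReflTransGen T.EpsStep p a ∧ Relation.ReflTransGen T.EpsStep b q := by
  induction h with
  | nil q => exact absurd rfl hv
  | @cons p q r x y u v he h ih =>
    cases x with
    | some x => simp at hu
    | none =>
      have hu : u = [] := by simpa using hu
      cases y with
      | some y => exact ⟨p, q, y, he, .refl, h.eps hu⟩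
      | none =>
        obtain ⟨a, b, y, h1, h2, h3⟩ := ih hu (by simpa using hv)
        exact ⟨a, b, y, h1, .head ⟨_, he⟩ h2, h3⟩

/-- The trim part has a proper cycle with empty input iff some transition from a useful state with
empty input and nonempty output lies on a cycle of transitions with empty input. -/
theorem trim_hasProperEpsCycle_iff : T.trim.HasProperEpsCycle ↔
    ∃ a b y, (a, none, some y, b) ∈ T.edges ∧ T.Useful a ∧
      Relation.ReflTransGen T.EpsStep b a := by
  constructor
  · rintro ⟨⟨q, ⟨i, hi, u₁, v₁, h₁⟩, f, hf, u₂, v₂, h₂⟩, v, hv, h⟩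
    obtain ⟨a, b, y, he, hqa, hbq⟩ := h.of_trim.exists_proper rfl hv
    obtain ⟨w₁, hw₁⟩ := exists_path_of_eps hqa
    obtain ⟨w₂, hw₂⟩ := exists_path_of_eps hbq
    exact ⟨a, b, y, he, ⟨⟨i, hi, _, _, h₁.append hw₁⟩, f, hf, _, _,
      Path.cons he (hw₂.append h₂)⟩, hbq.trans hqa⟩
  · rintro ⟨a, b, y, he, hu, hba⟩
    obtain ⟨w, hw⟩ := exists_path_of_eps hba
    exact ⟨⟨a, hu⟩, y :: w, by simp, (Path.cons he hw).to_trim hu hu⟩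

theorem _root_.NFA.mem_evalFrom_toList_append {A : NFA α S} {r t : S} {x : Option α}
    {u : List α} : t ∈ A.evalFrom {r} (x.toList ++ u) ↔
      ∃ s, A.OptStep r x s ∧ t ∈ A.evalFrom {s} u := by
  cases x with
  | none => simp [NFA.OptStep]
  | some a =>
    simp only [Option.toList_some, List.singleton_append, NFA.evalFrom_cons,
      NFA.stepSet_singleton, NFA.OptStep]
    exact NFA.mem_evalFrom_iff_exists

theorem restrictInput_path_iff {A : NFA α S} {p q : Q × S} {u v : List α} :
    (T.restrictInput A).Path p u v q ↔ T.Path p.1 u v q.1 ∧ q.2 ∈ A.evalFrom {p.2} u := by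
  constructor
  · intro h
    induction h with
    | nil q => exact ⟨Path.nil _, by simp⟩
    | cons he _ ih =>
      exact ⟨Path.cons he.1 ih.1, NFA.mem_evalFrom_toList_append.2 ⟨_, he.2, ih.2⟩⟩
  · obtain ⟨p, r⟩ := p
    obtain ⟨q, t⟩ := q
    rintro ⟨h, ht⟩
    simp only at h ht
    induction h generalizing r with
    | nil q =>
      obtain rfl : t = r := by simpa using ht
      exact Path.nil _
    | cons he _ ih =>
      obtain ⟨s, hs, ht⟩ := NFA.mem_evalFrom_toList_append.1 ht
      exact Path.cons (T := T.restrictInput A) (q := (_, s)) ⟨he, hs⟩ (ih _ ht)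

theorem restrictOutput_path_iff {A : NFA α S} {p q : Q × S} {u v : List α} :
    (T.restrictOutput A).Path p u v q ↔ T.Path p.1 u v q.1 ∧ q.2 ∈ A.evalFrom {p.2} v := by
  constructor
  · intro h
    induction h with
    | nil q => exact ⟨Path.nil _, by simp⟩
    | cons he _ ih =>
      exact ⟨Path.cons he.1 ih.1, NFA.mem_evalFrom_toList_append.2 ⟨_, he.2, ih.2⟩⟩
  · obtain ⟨p, r⟩ := p
    obtain ⟨q, t⟩ := q
    rintro ⟨h, ht⟩
    simp only at h ht
    induction h generalizing r with
    | nil q =>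
      obtain rfl : t = r := by simpa using ht
      exact Path.nil _
    | cons he _ ih =>
      obtain ⟨s, hs, ht⟩ := NFA.mem_evalFrom_toList_append.1 ht
      exact Path.cons (T := T.restrictOutput A) (q := (_, s)) ⟨he, hs⟩ (ih _ ht)

theorem _root_.NFA.mem_accepts_iff {A : NFA α S} {u : List α} :
    u ∈ A.accepts ↔ ∃ s ∈ A.start, ∃ t ∈ A.accept, t ∈ A.evalFrom {s} u := by
  rw [NFA.mem_accepts]
  constructor
  · rintro ⟨t, ht, h⟩
    obtain ⟨s, hs, h⟩ := (NFA.mem_evalFrom_iff_exists).1 h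
    exact ⟨s, hs, t, ht, h⟩
  · rintro ⟨s, hs, t, ht, h⟩
    exact ⟨t, ht, (NFA.mem_evalFrom_iff_exists).2 ⟨s, hs, h⟩⟩

theorem mem_outputs_restrict_iff {A : NFA α S} {u v : List α} :
    v ∈ ((T.restrictInput A).restrictOutput A).outputs u ↔
      u ∈ A.accepts ∧ v ∈ T.outputs u ∧ v ∈ A.accepts := by
  simp only [NFA.mem_accepts_iff]
  constructor
  · rintro ⟨⟨⟨p, r⟩, s⟩, ⟨⟨hp, hr⟩, hs⟩, ⟨⟨q, r'⟩, s'⟩, ⟨⟨hq, hr'⟩, hs'⟩, h⟩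
    obtain ⟨h, h'⟩ := restrictOutput_path_iff.1 h
    obtain ⟨h, h''⟩ := restrictInput_path_iff.1 h
    exact ⟨⟨r, hr, r', hr', h''⟩, ⟨p, hp, q, hq, h⟩, s, hs, s', hs', h'⟩
  · rintro ⟨⟨r, hr, r', hr', h''⟩, ⟨p, hp, q, hq, h⟩, s, hs, s', hs', h'⟩
    exact ⟨((p, r), s), ⟨⟨hp, hr⟩, hs⟩, ((q, r'), s'), ⟨⟨hq, hr'⟩, hs'⟩,
      restrictOutput_path_iff.2 ⟨restrictInput_path_iff.2 ⟨h, h''⟩, h'⟩⟩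

theorem finMarginal_iff [Finite α] [Finite Q] [Finite S] (A : NFA α S) :
    T.FinMarginal A.accepts ↔
      ¬ ((T.restrictInput A).restrictOutput A).trim.HasProperEpsCycle := by
  rw [← forall_finite_outputs_iff]
  refine forall_congr' fun u => ?_
  by_cases hu : u ∈ A.accepts
  · have : ((T.restrictInput A).restrictOutput A).outputs u =
        {v | v ∈ T.outputs u ∧ v ∈ A.accepts} := by
      ext v
      simp [mem_outputs_restrict_iff, hu]
    simp [this, hu]
  · have : ((T.restrictInput A).restrictOutput A).outputs u = ∅ := by
      ext v
      simp [mem_outputs_restrict_iff, hu]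
    simp [this, hu]

end Transducer

/-! ### Reasoning about random access machines -/

namespace RAM

@[simp] theorem State.setReg_reg (s : State) (r v : ℕ) :
    (s.setReg r v).reg = Function.update s.reg r v := rfl

@[simp] theorem State.setReg_arr (s : State) (r v : ℕ) : (s.setReg r v).arr = s.arr := rfl

@[simp] theorem State.setArr_reg (s : State) (a i v : ℕ) : (s.setArr a i v).reg = s.reg := rfl

@[simp] theorem State.setArr_arr (s : State) (a i v : ℕ) : (s.setArr a i v).arr =
    Function.update s.arr a (Function.update (s.arr a) i v) := rfl

/-- `P` may write into register `x`. -/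
def Cmd.WritesReg : Cmd → ℕ → Prop
  | .const r _, x | .move r _, x | .add r _ _, x | .sub r _ _, x | .mul r _ _, x
  | .load r _ _, x => x = r
  | .skip, _ | .store _ _ _, _ => False
  | .seq P₁ P₂, x | .ite _ P₁ P₂, x => P₁.WritesReg x ∨ P₂.WritesReg x
  | .loop _ P, x => P.WritesReg x

/-- `P` may write into array `x`. -/
def Cmd.WritesArr : Cmd → ℕ → Prop
  | .const _ _, _ | .move _ _, _ | .add _ _ _, _ | .sub _ _ _, _ | .mul _ _ _, _
  | .load _ _ _, _ | .skip, _ => False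
  | .store a _ _, x => x = a
  | .seq P₁ P₂, x | .ite _ P₁ P₂, x => P₁.WritesArr x ∨ P₂.WritesArr x
  | .loop _ P, x => P.WritesArr x

/-- `s'` agrees with `s` on everything that `P` does not write. -/
def Agree (P : Cmd) (s s' : State) : Prop :=
  (∀ r, ¬ P.WritesReg r → s'.reg r = s.reg r) ∧ ∀ a, ¬ P.WritesArr a → s'.arr a = s.arr a

theorem Agree.refl (P : Cmd) (s : State) : Agree P s s := ⟨fun _ _ => rfl, fun _ _ => rfl⟩

theorem Agree.trans {P : Cmd} {s s' s'' : State} (h : Agree P s s') (h' : Agree P s' s'') :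
    Agree P s s'' :=
  ⟨fun r hr => (h'.1 r hr).trans (h.1 r hr), fun a ha => (h'.2 a ha).trans (h.2 a ha)⟩

theorem Agree.mono {P P' : Cmd} {s s' : State} (h : Agree P s s')
    (h₁ : ∀ r, P.WritesReg r → P'.WritesReg r) (h₂ : ∀ a, P.WritesArr a → P'.WritesArr a) :
    Agree P' s s' :=
  ⟨fun r hr => h.1 r (mt (h₁ r) hr), fun a ha => h.2 a (mt (h₂ a) ha)⟩

theorem Exec.agree {B : ℕ} {P : Cmd} {s s' : State} {t : ℕ} (h : Exec B P s t s') :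
    Agree P s s' := by
  induction h with
  | skip s => exact Agree.refl _ _
  | const s r c h => exact ⟨fun x hx => Function.update_of_ne hx _ _, fun _ _ => rfl⟩
  | move s r i => exact ⟨fun x hx => Function.update_of_ne hx _ _, fun _ _ => rfl⟩
  | add s r i j h => exact ⟨fun x hx => Function.update_of_ne hx _ _, fun _ _ => rfl⟩
  | sub s r i j => exact ⟨fun x hx => Function.update_of_ne hx _ _, fun _ _ => rfl⟩
  | mul s r i j h => exact ⟨fun x hx => Function.update_of_ne hx _ _, fun _ _ => rfl⟩
  | load s r a i => exact ⟨fun x hx => Function.update_of_ne hx _ _, fun _ _ => rfl⟩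
  | store s a i j => exact ⟨fun _ _ => rfl, fun x hx => Function.update_of_ne hx _ _⟩
  | @seq P₁ P₂ _ _ _ _ _ _ _ ih₁ ih₂ =>
    exact Agree.trans (P := .seq P₁ P₂) (ih₁.mono (fun _ h => Or.inl h) fun _ h => Or.inl h)
      (ih₂.mono (fun _ h => Or.inr h) fun _ h => Or.inr h)
  | ite_pos _ _ ih => exact ih.mono (fun _ h => Or.inl h) fun _ h => Or.inl h
  | ite_neg _ _ ih => exact ih.mono (fun _ h => Or.inr h) fun _ h => Or.inr h
  | loop_exit _ => exact Agree.refl _ _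
  | loop_step _ _ _ ih₁ ih₂ => exact ih₁.trans ih₂

/-- With word bound `B`, the program `P`, started in `s`, halts after at most `k` steps in a state
with the property `R`. -/
def Run (B : ℕ) (P : Cmd) (s : State) (k : ℕ) (R : State → Prop) : Prop :=
  ∃ t s', Exec B P s t s' ∧ t ≤ k ∧ R s'

variable {B : ℕ} {P P₁ P₂ : Cmd} {s : State} {k k₁ k₂ : ℕ} {R R' : State → Prop}

theorem Run.mono (h : Run B P s k₁ R) (hk : k₁ ≤ k₂) (hR : ∀ s', R s' → R' s') :
    Run B P s k₂ R' := by
  obtain ⟨t, s', h, ht, hs⟩ := h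
  exact ⟨t, s', h, ht.trans hk, hR _ hs⟩

/-- The frame rule. -/
theorem Run.frame (h : Run B P s k R) : Run B P s k fun s' => R s' ∧ Agree P s s' := by
  obtain ⟨t, s', h, ht, hs⟩ := h
  exact ⟨t, s', h, ht, hs, h.agree⟩

theorem Run.seq (h₁ : Run B P₁ s k₁ R) (h₂ : ∀ s', R s' → Agree P₁ s s' → Run B P₂ s' k₂ R') :
    Run B (.seq P₁ P₂) s (k₁ + k₂) R' := by
  obtain ⟨t₁, s₁, e₁, ht₁, hs₁⟩ := h₁
  obtain ⟨t₂, s₂, e₂, ht₂, hs₂⟩ := h₂ s₁ hs₁ e₁.agree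
  exact ⟨_, s₂, e₁.seq e₂, by omega, hs₂⟩

/-- The loop rule, with an invariant `I` and a bound `Φ` on the number of iterations. -/
theorem Run.loop {r : ℕ} {s₀ : State} (I : State → Prop) (Φ : State → ℕ) (h₀ : I s₀)
    (step : ∀ s, I s → Agree P s₀ s → s.reg r ≠ 0 → Run B P s k fun s' => I s' ∧ Φ s' < Φ s) :
    Run B (.loop r P) s₀ (Φ s₀ * (k + 1) + 1) fun s' => I s' ∧ s'.reg r = 0 := by
  suffices H : ∀ N s, Φ s = N → I s → Agree P s₀ s →
      Run B (.loop r P) s (N * (k + 1) + 1) fun s' => I s' ∧ s'.reg r = 0 from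
    H _ s₀ rfl h₀ (Agree.refl _ _)
  intro N
  induction N using Nat.strong_induction_on with
  | _ N ih =>
    intro s hN hI hs
    by_cases hr : s.reg r = 0
    · exact ⟨1, s, .loop_exit hr, by omega, hI, hr⟩
    · obtain ⟨t₁, s₁, e₁, ht₁, hI₁, hΦ⟩ := step s hI hs hr
      obtain ⟨t₂, s₂, e₂, ht₂, h₂⟩ := ih _ (hN ▸ hΦ) s₁ rfl hI₁ (hs.trans e₁.agree)
      refine ⟨_, s₂, .loop_step hr e₁ e₂, ?_, h₂⟩
      have : (Φ s₁ + 1) * (k + 1) ≤ N * (k + 1) := Nat.mul_le_mul_right _ (hN ▸ hΦ)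
      have e : (Φ s₁ + 1) * (k + 1) = Φ s₁ * (k + 1) + k + 1 := by ring
      omega

/-- The weakest precondition of a program without loops. -/
def wp (B : ℕ) : Cmd → (State → Prop) → State → Prop
  | .skip, R, s => R s
  | .const r c, R, s => c < B ∧ R (s.setReg r c)
  | .move r i, R, s => R (s.setReg r (s.reg i))
  | .add r i j, R, s => s.reg i + s.reg j < B ∧ R (s.setReg r (s.reg i + s.reg j))
  | .sub r i j, R, s => R (s.setReg r (s.reg i - s.reg j))
  | .mul r i j, R, s => s.reg i * s.reg j < B ∧ R (s.setReg r (s.reg i * s.reg j))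
  | .load r a i, R, s => R (s.setReg r (s.arr a (s.reg i)))
  | .store a i j, R, s => R (s.setArr a (s.reg i) (s.reg j))
  | .seq P₁ P₂, R, s => wp B P₁ (wp B P₂ R) s
  | .ite r P₁ P₂, R, s => (s.reg r ≠ 0 → wp B P₁ R s) ∧ (s.reg r = 0 → wp B P₂ R s)
  | .loop _ _, _, _ => False

/-- A bound on the running time of a program without loops. -/
def Cmd.cost : Cmd → ℕ
  | .seq P₁ P₂ => P₁.cost + P₂.cost
  | .ite _ P₁ P₂ => P₁.cost + P₂.cost + 1
  | _ => 1

theorem Run.of_wp (h : wp B P R s) : Run B P s P.cost R := by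
  induction P generalizing s R with
  | skip => exact ⟨_, _, .skip _, le_rfl, h⟩
  | const r c => exact ⟨_, _, .const _ _ _ h.1, le_rfl, h.2⟩
  | move r i => exact ⟨_, _, .move _ _ _, le_rfl, h⟩
  | add r i j => exact ⟨_, _, .add _ _ _ _ h.1, le_rfl, h.2⟩
  | sub r i j => exact ⟨_, _, .sub _ _ _ _, le_rfl, h⟩
  | mul r i j => exact ⟨_, _, .mul _ _ _ _ h.1, le_rfl, h.2⟩
  | load r a i => exact ⟨_, _, .load _ _ _ _, le_rfl, h⟩
  | store a i j => exact ⟨_, _, .store _ _ _ _, le_rfl, h⟩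
  | seq P₁ P₂ ih₁ ih₂ => exact Run.seq (ih₁ h) fun s' hs' _ => ih₂ hs'
  | ite r P₁ P₂ ih₁ ih₂ =>
    by_cases hr : s.reg r = 0
    · obtain ⟨t, s', e, ht, hs⟩ := ih₂ (h.2 hr)
      exact ⟨_, s', .ite_neg hr e, by simp only [Cmd.cost]; omega, hs⟩
    · obtain ⟨t, s', e, ht, hs⟩ := ih₁ (h.1 hr)
      exact ⟨_, s', .ite_pos hr e, by simp only [Cmd.cost]; omega, hs⟩
  | loop r P => exact h.elim

/-- A list of programs, executed one after the other. -/
def Cmd.block : List Cmd → Cmd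
  | [] => .skip
  | [P] => P
  | P :: Ps => .seq P (block Ps)

/-- `for i := 0, …, reg n - 1 do P`, with counter `reg i` and auxiliary register `t`. -/
def Cmd.forLoop (i n t : ℕ) (P : Cmd) : Cmd :=
  .seq (.seq (.const i 0) (.sub t n i))
    (.loop t (.seq P (.seq (.const t 1) (.seq (.add i i t) (.sub t n i)))))

/-- The rule for counting loops. The invariant `I j` has to be stable under changes of the counter
and of the auxiliary register. -/
theorem Run.forLoop {i n t N : ℕ} {s₀ : State} (I : ℕ → State → Prop)
    (hin : i ≠ n) (hit : i ≠ t) (hnt : n ≠ t) (hiP : ¬ P.WritesReg i) (hnP : ¬ P.WritesReg n)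
    (hn : s₀.reg n = N) (hN : N + 1 < B)
    (hI : ∀ j s v w, I j s → I j ((s.setReg i v).setReg t w)) (h₀ : I 0 s₀)
    (step : ∀ j < N, ∀ s, I j s → Agree (.forLoop i n t P) s₀ s → s.reg i = j →
      Run B P s k (I (j + 1))) :
    Run B (.forLoop i n t P) s₀ (N * (k + 4) + 3) (I N) := by
  have hadd : ∀ j v, ∀ s : State, I j s → I j (s.setReg i v) := fun j v s h => by
    have := hI j s v (s.reg t) h
    convert this using 1
    simp only [State.setReg, State.mk.injEq, and_true]
    funext x
    by_cases hx : x = t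
    · subst hx; simp [Ne.symm hit]
    · simp [hx]
  have hadt : ∀ j v, ∀ s : State, I j s → I j (s.setReg t v) := fun j v s h => by
    have := hI j s (s.reg i) v h
    convert this using 1
    simp only [State.setReg, State.mk.injEq, and_true]
    funext x
    by_cases hx : x = t
    · subst hx; simp
    · simp only [Function.update_of_ne hx]
      by_cases hx : x = i
      · subst hx; simp
      · simp [hx]
  have init : Run B (.seq (.const i 0) (.sub t n i)) s₀ 2 fun s' =>
      I 0 s' ∧ s'.reg i = 0 ∧ s'.reg n = N ∧ s'.reg t = N - 0 := by
    refine Run.of_wp ⟨by omega, ?_⟩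
    refine ⟨hI _ _ _ _ h₀, ?_, ?_, ?_⟩ <;> simp [hin.symm, hn, hit, hnt]
  refine (Run.seq init (k₂ := N * (k + 4) + 1) fun s₁ h₁ hs₁ => ?_).mono (by omega) fun _ h => h
  have := Run.loop (B := B) (s₀ := s₁) (r := t) (k := k + 3)
    (P := .seq P (.seq (.const t 1) (.seq (.add i i t) (.sub t n i))))
    (fun s => ∃ j ≤ N, I j s ∧ s.reg i = j ∧ s.reg n = N ∧ s.reg t = N - j)
    (fun s => s.reg t) ⟨0, by omega, h₁⟩ ?_
  · refine this.mono ?_ ?_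
    · rw [h₁.2.2.2]; simp [add_assoc]
    · rintro s ⟨⟨j, hj, hI', -, -, ht⟩, ht'⟩
      obtain rfl : j = N := by omega
      exact hI'
  · rintro s ⟨j, hj, hI', hi, hn', ht⟩ hs ht'
    have hj' : j < N := by omega
    have ag : Agree (.forLoop i n t P) s₀ s :=
      Agree.trans (Agree.mono hs₁ (fun _ h => Or.inl h) fun _ h => Or.inl h)
        (Agree.mono hs (fun _ h => Or.inr h) fun _ h => Or.inr h)
    refine Run.seq (k₂ := 3) (step j hj' s hI' ag hi) fun s' hs' ha => Run.of_wp ?_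
    have hi' : s'.reg i = j := (ha.1 i hiP).trans hi
    have hn'' : s'.reg n = N := (ha.1 n hnP).trans hn'
    refine ⟨by omega, by simp [hit, hi']; omega, ⟨j + 1, by omega, ?_, ?_, ?_, ?_⟩, ?_⟩
    · exact hadt _ _ _ (hadd _ _ _ (hadt _ _ _ hs'))
    · simp [hit, hi']
    · simp [hin.symm, hnt, hn'']
    · simp [hit, hin.symm, hnt, hi', hn'']
    · simp [hit, hin.symm, hnt, hi', hn'', ht]; omega

end RAM

/-! ### Depth-first search -/

namespace DFS

open Relation

/-- The edge relation of the graph whose edges `1, …, M` have the sources `S e` and the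
targets `G e`. -/
def Edge (M : ℕ) (S G : ℕ → ℕ) (u w : ℕ) : Prop := ∃ e, 1 ≤ e ∧ e ≤ M ∧ S e = u ∧ G e = w

/-- `X` links every edge to the previous edge with the same source, or to `0`. -/
def Linked (M : ℕ) (S X : ℕ → ℕ) : Prop :=
  ∀ e, 1 ≤ e → e ≤ M → X e < e ∧ (X e ≠ 0 → S (X e) = S e) ∧
    ∀ e', 1 ≤ e' → e' < e → S e' = S e → e' ≤ X e

/-- `H` gives the last edge with a given source, or `0`. -/
def Heads (M : ℕ) (S H : ℕ → ℕ) : Prop :=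
  ∀ u, H u ≤ M ∧ (H u ≠ 0 → S (H u) = u) ∧ ∀ e, 1 ≤ e → e ≤ M → S e = u → e ≤ H u

/-- A configuration of a depth-first search. -/
structure Config where
  /-- the number of roots that have not been considered yet; root `j` is taken after root `j + 1` -/
  i : ℕ
  /-- the stack, top first -/
  stk : List ℕ
  /-- the nodes that are finished, the last one first -/
  post : List ℕ
  /-- `0` for a node that has not been visited, `j + 1` for a node visited from root `j` -/
  L : ℕ → ℕ
  /-- the edges with source `u` and a number larger than `H u` have been examined -/
  H : ℕ → ℕ

variable {K M : ℕ} {S G R X : ℕ → ℕ} {c : Config}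

/-- The invariant of depth-first search on a graph with nodes `0, …, K - 1`. -/
structure Inv (K M : ℕ) (S G R : ℕ → ℕ) (c : Config) : Prop where
  nodup : (c.stk ++ c.post).Nodup
  vis : ∀ v, c.L v ≠ 0 ↔ v ∈ c.stk ∨ v ∈ c.post
  lt : ∀ v, c.L v ≠ 0 → v < K
  head : ∀ u, c.H u ≤ M ∧ (c.H u ≠ 0 → S (c.H u) = u)
  /-- All edges of a finished node have been examined. -/
  done : ∀ v ∈ c.post, c.H v = 0
  /-- The target of an examined edge is visited, and not from a later root than the source. -/
  proc : ∀ e, 1 ≤ e → e ≤ M → c.H (S e) < e → c.L (G e) ≠ 0 ∧ c.L (S e) ≤ c.L (G e)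
  lab : ∀ v, c.L v ≠ 0 → c.i + 1 ≤ c.L v ∧ c.L v ≤ K ∧
    ReflTransGen (Edge M S G) (R (c.L v - 1)) v
  /-- The nodes on the stack have been visited from the current root. -/
  cur : ∀ v ∈ c.stk, c.L v = c.i + 1
  chain : c.stk.Pairwise fun a b => ReflTransGen (Edge M S G) b a
  /-- A finished node that still reaches the stack is strongly connected with a node on it. -/
  back : ∀ x ∈ c.post, ∀ g ∈ c.stk, ReflTransGen (Edge M S G) x g →
    ∃ g' ∈ c.stk, ReflTransGen (Edge M S G) x g' ∧ ReflTransGen (Edge M S G) g' x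
  /-- A finished node `x` that reaches a node `r` finished later is strongly connected with a node
  that is finished no earlier than `r`. -/
  order : ∀ l₁ r l₂, c.post = l₁ ++ r :: l₂ → ∀ x ∈ l₂, ReflTransGen (Edge M S G) x r →
    ∃ y, (y ∈ c.stk ∨ y ∈ l₁ ∨ y = r) ∧
      ReflTransGen (Edge M S G) x y ∧ ReflTransGen (Edge M S G) y x

/-- The roots that have been considered are visited, at the latest from themselves. -/
def RootsDone (K : ℕ) (R : ℕ → ℕ) (c : Config) : Prop :=
  ∀ j, c.i ≤ j → j < K → j + 1 ≤ c.L (R j)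

theorem Inv.init {H : ℕ → ℕ} (hH : Heads M S H) :
    Inv K M S G R ⟨K, [], [], fun _ => 0, H⟩ where
  nodup := by simp
  vis := by simp
  lt := by simp
  head u := ⟨(hH u).1, (hH u).2.1⟩
  done := by simp
  proc e h1 h2 h := absurd ((hH (S e)).2.2 e h1 h2 rfl) (by simpa using h)
  lab := by simp
  cur := by simp
  chain := by simp
  back := by simp
  order := by simp

/-- The search leaves the finished nodes only through the stack. -/
theorem Inv.reach_post (h : Inv K M S G R c) {x z : ℕ} (hx : x ∈ c.post)
    (hz : ReflTransGen (Edge M S G) x z) :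
    z ∈ c.post ∨ ∃ g ∈ c.stk, ReflTransGen (Edge M S G) x g := by
  induction hz with
  | refl => exact .inl hx
  | @tail y z hxy hyz ih =>
    rcases ih with hy | hg
    · obtain ⟨e, h1, h2, rfl, rfl⟩ := hyz
      have := (h.proc e h1 h2 (by rw [h.done _ hy]; omega)).1
      rcases (h.vis _).1 this with hg | hg
      · exact .inr ⟨_, hg, hxy.tail ⟨e, h1, h2, rfl, rfl⟩⟩
      · exact .inl hg
    · exact .inr hg

/-- Considering the next root, when the stack is empty. -/
theorem Inv.nextRoot (h : Inv K M S G R c) (hs : c.stk = []) :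
    Inv K M S G R { c with i := c.i - 1 } where
  nodup := h.nodup
  vis := h.vis
  lt := h.lt
  head := h.head
  done := h.done
  proc := h.proc
  lab v hv := ⟨by have := (h.lab v hv).1; simp only; omega, (h.lab v hv).2⟩
  cur := by simp [hs]
  chain := h.chain
  back := h.back
  order := h.order

/-- Visiting a new node. -/
theorem Inv.push (h : Inv K M S G R c) {w : ℕ} (hw : c.L w = 0) (hwK : w < K) (hi : c.i + 1 ≤ K)
    (hroot : ReflTransGen (Edge M S G) (R c.i) w)
    (hstk : ∀ v ∈ c.stk, ReflTransGen (Edge M S G) v w) :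
    Inv K M S G R { c with stk := w :: c.stk, L := Function.update c.L w (c.i + 1) } where
  nodup := by
    have : ¬ (w ∈ c.stk ∨ w ∈ c.post) := fun hm => (h.vis w).2 hm hw
    simp only [List.cons_append, List.nodup_cons, List.mem_append]
    exact ⟨this, h.nodup⟩
  vis v := by
    by_cases hv : v = w
    · subst hv; simp
    · simp only [Function.update_of_ne hv, List.mem_cons, hv, false_or]
      exact h.vis v
  lt v := by
    by_cases hv : v = w
    · subst hv; simpa using hwK
    · simpa only [Function.update_of_ne hv] using h.lt v
  head := h.head
  done := h.done
  proc e h1 h2 he := by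
    obtain ⟨h3, h4⟩ := h.proc e h1 h2 he
    have hne : G e ≠ w := fun heq => h3 (heq ▸ hw)
    simp only [Function.update_of_ne hne]
    refine ⟨h3, ?_⟩
    by_cases hv : S e = w
    · simpa [hv] using (h.lab _ h3).1
    · simpa only [Function.update_of_ne hv] using h4
  lab v := by
    by_cases hv : v = w
    · subst hv; simpa using ⟨hi, hroot⟩
    · simpa only [Function.update_of_ne hv] using h.lab v
  cur v hv := by
    rcases List.mem_cons.1 hv with rfl | hv
    · simp
    · have := h.cur v hv
      by_cases hv : v = w
      · subst hv; simp
      · simpa only [Function.update_of_ne hv] using this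
  chain := List.pairwise_cons.2 ⟨hstk, h.chain⟩
  back x hx g hg hxg := by
    obtain ⟨g', hg', hxg'⟩ : ∃ g ∈ c.stk, ReflTransGen (Edge M S G) x g := by
      rcases List.mem_cons.1 hg with rfl | hg
      · refine (h.reach_post hx hxg).resolve_left fun hg => ?_
        exact (h.vis g).2 (.inr hg) hw
      · exact ⟨g, hg, hxg⟩
    obtain ⟨y, hy, hxy⟩ := h.back x hx g' hg' hxg'
    exact ⟨y, List.mem_cons_of_mem _ hy, hxy⟩
  order l₁ r l₂ hp x hx hxr := by
    obtain ⟨y, hy, hxy⟩ := h.order l₁ r l₂ hp x hx hxr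
    exact ⟨y, hy.imp_left (List.mem_cons_of_mem _), hxy⟩

/-- Advancing to the next edge of a node on the stack. -/
theorem Inv.advance (h : Inv K M S G R c) (hX : Linked M S X) {u : ℕ} (hu : u ∈ c.stk)
    (hHu : c.H u ≠ 0) (hvis : c.L (G (c.H u)) ≠ 0) :
    Inv K M S G R { c with H := Function.update c.H u (X (c.H u)) } := by
  have h1 : 1 ≤ c.H u := by omega
  obtain ⟨hM, hS⟩ := h.head u
  have hS := hS hHu
  obtain ⟨hlt, hSX, hmax⟩ := hX _ h1 hM
  exact
  { nodup := h.nodup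
    vis := h.vis
    lt := h.lt
    head := fun v => by
      by_cases hv : v = u
      · subst hv
        simp only [Function.update_self]
        exact ⟨by omega, fun hne => (hSX hne).trans hS⟩
      · simpa only [Function.update_of_ne hv] using h.head v
    done := fun v hv => by
      have hne : v ≠ u := by
        rintro rfl
        exact (List.nodup_append.1 h.nodup).2.2 _ hu _ hv rfl
      simpa only [Function.update_of_ne hne] using h.done v hv
    proc := fun e h1 h2 he => by
      by_cases hv : S e = u
      · by_cases hle : c.H u < e
        · exact h.proc e h1 h2 (hv ▸ hle)
        · have : e = c.H u := by
            by_contra hne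
            have := hmax e h1 (by omega) (hv.trans hS.symm)
            simp only [hv, Function.update_self] at he
            omega
          subst this
          have hcur := h.cur _ hu
          have := (h.lab _ hvis).1
          exact ⟨hvis, by simp only [hv]; omega⟩
      · simp only [Function.update_of_ne hv] at he
        exact h.proc e h1 h2 he
    lab := h.lab
    cur := h.cur
    chain := h.chain
    back := h.back
    order := h.order }

/-- Finishing the node on top of the stack. -/
theorem Inv.pop (h : Inv K M S G R c) {u : ℕ} {t : List ℕ} (hs : c.stk = u :: t)
    (hu : c.H u = 0) : Inv K M S G R { c with stk := t, post := u :: c.post } := by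
  have hut : ∀ g ∈ t, ReflTransGen (Edge M S G) g u :=
    (List.pairwise_cons.1 (hs ▸ h.chain)).1
  exact
  { nodup := by
      have := h.nodup
      rw [hs] at this
      exact (List.perm_middle.nodup_iff).2 this
    vis := fun v => by
      rw [h.vis v, hs]
      simp only [List.mem_cons]
      tauto
    lt := h.lt
    head := h.head
    done := fun v hv => by
      rcases List.mem_cons.1 hv with rfl | hv
      · exact hu
      · exact h.done v hv
    proc := h.proc
    lab := h.lab
    cur := fun v hv => h.cur v (hs ▸ List.mem_cons_of_mem _ hv)
    chain := (List.pairwise_cons.1 (hs ▸ h.chain)).2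
    back := fun x hx g hg hxg => by
      rcases List.mem_cons.1 hx with rfl | hx
      · exact ⟨g, hg, hxg, hut g hg⟩
      · obtain ⟨g', hg', h1, h2⟩ := h.back x hx g (hs ▸ List.mem_cons_of_mem _ hg) hxg
        rcases List.mem_cons.1 (hs ▸ hg') with rfl | hg'
        -- the finished node was the witness: then the next stack node that `x` reaches takes over
        · exact ⟨g, hg, hxg, (hut g hg).trans h2⟩
        · exact ⟨g', hg', h1, h2⟩
    order := fun l₁ r l₂ hp x hx hxr => by
      cases l₁ with
      | nil =>
        obtain ⟨rfl, rfl⟩ : u = r ∧ c.post = l₂ := by simpa using hp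
        obtain ⟨g', hg', h1, h2⟩ := h.back x hx u (hs ▸ List.mem_cons_self) hxr
        rcases List.mem_cons.1 (hs ▸ hg') with rfl | hg'
        · exact ⟨_, .inr (.inr rfl), h1, h2⟩
        · exact ⟨_, .inl hg', h1, h2⟩
      | cons a l₁ =>
        obtain ⟨rfl, hp'⟩ : u = a ∧ c.post = l₁ ++ r :: l₂ := by simpa using hp
        obtain ⟨y, hy, hxy⟩ := h.order l₁ r l₂ hp' x hx hxr
        refine ⟨y, ?_, hxy⟩
        rw [hs] at hy
        simp only [List.mem_cons] at hy ⊢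
        tauto }

theorem Inv.length_le (h : Inv K M S G R c) : c.stk.length + c.post.length ≤ K := by
  rw [← List.length_append]
  have hsub : (c.stk ++ c.post).toFinset ⊆ Finset.range K := fun v hv =>
    Finset.mem_range.2 (h.lt v ((h.vis v).2 (by simpa using hv)))
  have := Finset.card_le_card hsub
  rwa [List.toFinset_card_of_nodup h.nodup, Finset.card_range] at this

/-- The edges that have not been examined. -/
def rest (M : ℕ) (S H : ℕ → ℕ) : Finset ℕ := (Finset.Icc 1 M).filter fun e => e ≤ H (S e)

theorem card_rest_le (M : ℕ) (S H : ℕ → ℕ) : (rest M S H).card ≤ M :=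
  (Finset.card_filter_le _ _).trans (by simp)

theorem Inv.card_rest_advance_lt (h : Inv K M S G R c) (hX : Linked M S X) {u : ℕ}
    (hu : c.H u ≠ 0) :
    (rest M S (Function.update c.H u (X (c.H u)))).card < (rest M S c.H).card := by
  obtain ⟨hM, hS⟩ := h.head u
  have hS := hS hu
  have hlt := (hX _ (by omega) hM).1
  refine Finset.card_lt_card ⟨fun e he => ?_, fun hsub => ?_⟩
  · simp only [rest, Finset.mem_filter] at he ⊢
    refine ⟨he.1, ?_⟩
    by_cases hv : S e = u
    · have := he.2
      simp only [hv, Function.update_self] at this ⊢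
      omega
    · simpa only [Function.update_of_ne hv] using he.2
  · have := hsub (Finset.mem_filter.2 ⟨Finset.mem_Icc.2 ⟨by omega, hM⟩, (by rw [hS])⟩)
    simp only [rest, Finset.mem_filter, hS, Function.update_self] at this
    omega

/-! ### The result of a search -/

/-- The result of a search: `L` are the labels and `post` lists the visited nodes, the one that
was finished last first. -/
structure Result (K M : ℕ) (S G R L : ℕ → ℕ) (post : List ℕ) : Prop where
  nodup : post.Nodup
  vis : ∀ v, L v ≠ 0 ↔ v ∈ post
  lt : ∀ v, L v ≠ 0 → v < K
  /-- Along an edge, the target is not visited from a later root than the source. -/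
  edge : ∀ u w, Edge M S G u w → L u ≠ 0 → L w ≠ 0 ∧ L u ≤ L w
  lab : ∀ v, L v ≠ 0 → L v ≤ K ∧ ReflTransGen (Edge M S G) (R (L v - 1)) v
  /-- Root `j` is visited, at the latest from itself. As roots are taken in descending order, this
  means that its label is at least `j + 1`. -/
  root : ∀ j < K, j + 1 ≤ L (R j)
  /-- If `x` reaches a node `r` that is finished later, then some node in the strongly connected
  component of `x` is finished no earlier than `r`. -/
  order : ∀ l₁ r l₂, post = l₁ ++ r :: l₂ → ∀ x ∈ l₂, ReflTransGen (Edge M S G) x r →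
    ∃ y, (y ∈ l₁ ∨ y = r) ∧ ReflTransGen (Edge M S G) x y ∧ ReflTransGen (Edge M S G) y x

theorem Inv.result (h : Inv K M S G R c) (hr : RootsDone K R c) (hi : c.i = 0)
    (hs : c.stk = []) : Result K M S G R c.L c.post where
  nodup := by simpa [hs] using h.nodup
  vis v := by simpa [hs] using h.vis v
  lt := h.lt
  edge := by
    rintro _ _ ⟨e, h1, h2, rfl, rfl⟩ hu
    have hp : S e ∈ c.post := by simpa [hs, hu] using h.vis (S e)
    exact h.proc e h1 h2 (by rw [h.done _ hp]; omega)
  lab v hv := (h.lab v hv).2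
  root j hj := hr j (by omega) hj
  order l₁ r l₂ hp x hx hxr := by simpa [hs] using h.order l₁ r l₂ hp x hx hxr

variable {L L' P : ℕ → ℕ} {post post' : List ℕ}

theorem Result.reach (h : Result K M S G R L post) {u w : ℕ}
    (huw : ReflTransGen (Edge M S G) u w) (hu : L u ≠ 0) : L w ≠ 0 ∧ L u ≤ L w := by
  induction huw with
  | refl => exact ⟨hu, le_rfl⟩
  | tail _ hyz ih =>
    have := h.edge _ _ hyz ih.1
    exact ⟨this.1, ih.2.trans this.2⟩

theorem Result.ne_zero_iff (h : Result K M S G R L post) (v : ℕ) :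
    L v ≠ 0 ↔ ∃ j < K, ReflTransGen (Edge M S G) (R j) v := by
  constructor
  · intro hv
    have := h.lab v hv
    exact ⟨L v - 1, by omega, this.2⟩
  · rintro ⟨j, hj, hv⟩
    have := h.root j hj
    exact (h.reach hv (by omega)).1

theorem reach_swap {u w : ℕ} :
    ReflTransGen (Edge M G S) u w ↔ ReflTransGen (Edge M S G) w u := by
  have : Edge M G S = Function.swap (Edge M S G) := by
    funext a b
    simp only [Function.swap, Edge, eq_iff_iff]
    exact ⟨fun ⟨e, h1, h2, h3, h4⟩ => ⟨e, h1, h2, h4, h3⟩,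
      fun ⟨e, h1, h2, h3, h4⟩ => ⟨e, h1, h2, h4, h3⟩⟩
  rw [this, reflTransGen_swap]

/-- `StackRep f l`: the cells `0, …, l.length - 1` of the array `f` hold the list `l`, the first
element in the last cell. -/
def StackRep (f : ℕ → ℕ) : List ℕ → Prop
  | [] => True
  | u :: t => f t.length = u ∧ StackRep f t

theorem StackRep.update {f : ℕ → ℕ} {l : List ℕ} (h : StackRep f l) {n : ℕ} (v : ℕ)
    (hn : l.length ≤ n) : StackRep (Function.update f n v) l := by
  induction l with
  | nil => trivial
  | cons u t ih =>
    simp only [List.length_cons] at hn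
    exact ⟨by rw [Function.update_of_ne (by omega)]; exact h.1, ih h.2 (by omega)⟩

theorem StackRep.exists_split {f : ℕ → ℕ} {l : List ℕ} (h : StackRep f l) {j : ℕ}
    (hj : j < l.length) : ∃ l₁ l₂, l = l₁ ++ f j :: l₂ ∧ l₂.length = j := by
  induction l with
  | nil => simp at hj
  | cons u t ih =>
    by_cases hjt : j = t.length
    · subst hjt
      exact ⟨[], t, by simp [h.1], rfl⟩
    · obtain ⟨l₁, l₂, h1, h2⟩ := ih h.2 (by simp at hj; omega)
      exact ⟨u :: l₁, l₂, by simp [← h1], h2⟩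

theorem StackRep.exists_index {f : ℕ → ℕ} {l l₁ l₂ : List ℕ} {r y : ℕ} (h : StackRep f l)
    (hl : l = l₁ ++ r :: l₂) (hy : y ∈ l₁ ∨ y = r) : ∃ j, l₂.length ≤ j ∧ j < l.length ∧ f j = y := by
  induction l generalizing l₁ with
  | nil => simp at hl
  | cons u t ih =>
    cases l₁ with
    | nil =>
      obtain ⟨rfl, rfl⟩ : u = r ∧ t = l₂ := by simpa using hl
      obtain rfl : y = u := by simpa using hy
      exact ⟨t.length, le_rfl, by simp, h.1⟩
    | cons a l₁ =>
      obtain ⟨rfl, rfl⟩ : u = a ∧ t = l₁ ++ r :: l₂ := by simpa using hl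
      rw [List.mem_cons, or_assoc] at hy
      rcases hy with rfl | hy
      · refine ⟨_, ?_, by simp, h.1⟩
        simp; omega
      · obtain ⟨j, h1, h2, h3⟩ := ih h.2 rfl hy
        exact ⟨j, h1, by simp at h2 ⊢; omega, h3⟩

/-- The algorithm of Kosaraju: after a search from all nodes, a search in the reversed graph that
takes the nodes in the reverse order of finishing finds the strongly connected components. -/
theorem Result.kosaraju (h : Result K M S G R L post) (hP : StackRep P post)
    (hlen : post.length = K) (h' : Result K M G S P L' post') {u w : ℕ} (hu : u < K) (hw : w < K) :
    L' u = L' w ↔ ReflTransGen (Edge M S G) u w ∧ ReflTransGen (Edge M S G) w u := by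
  have hall : ∀ v < K, v ∈ post := by
    have hsub : post.toFinset ⊆ Finset.range K := fun v hv =>
      Finset.mem_range.2 (h.lt v ((h.vis v).2 (by simpa using hv)))
    have heq := Finset.eq_of_subset_of_card_le hsub
      (by rw [List.toFinset_card_of_nodup h.nodup, hlen, Finset.card_range])
    intro v hv
    have := Finset.mem_range.2 hv
    rwa [← heq, List.mem_toFinset] at this
  have hne : ∀ v < K, L' v ≠ 0 := fun v hv => by
    obtain ⟨l₁, l₂, h1⟩ := List.append_of_mem (hall v hv)
    obtain ⟨j, -, hj, rfl⟩ := hP.exists_index h1 (.inr rfl)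
    have := h'.root j (hlen ▸ hj)
    omega
  have hle : ∀ u w, ReflTransGen (Edge M S G) u w → w < K → L' w ≤ L' u := fun u w huw hw =>
    (h'.reach (reach_swap.2 huw) (hne w hw)).2
  -- every node is strongly connected with the root that it was visited from
  have key : ∀ v < K, ReflTransGen (Edge M S G) v (P (L' v - 1)) ∧
      ReflTransGen (Edge M S G) (P (L' v - 1)) v := by
    intro v hv
    obtain ⟨hlab, hreach⟩ := h'.lab v (hne v hv)
    have hreach := reach_swap.1 hreach
    refine ⟨hreach, ?_⟩
    have hpos := hne v hv
    obtain ⟨l₁, l₂, hl, hl₂⟩ := hP.exists_split (j := L' v - 1) (by omega)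
    obtain ⟨y, hy, hvy, hyv⟩ : ∃ y, (y ∈ l₁ ∨ y = P (L' v - 1)) ∧
        ReflTransGen (Edge M S G) v y ∧ ReflTransGen (Edge M S G) y v := by
      have hmem := hall v hv
      rw [hl, List.mem_append, List.mem_cons, ← or_assoc] at hmem
      rcases hmem with hmem | hmem
      · exact ⟨v, hmem, .refl, .refl⟩
      · exact h.order _ _ _ hl v hmem hreach
    obtain ⟨j, h1, h2, rfl⟩ := hP.exists_index hl hy
    have hroot := h'.root j (by omega)
    have := hle _ _ hyv hv
    have := hle _ _ hvy (h'.lt _ (by omega))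
    obtain rfl : j = L' v - 1 := by omega
    exact hyv
  constructor
  · intro heq
    have hu' := key u hu
    have hw' := key w hw
    rw [← heq] at hw'
    exact ⟨hu'.1.trans hw'.2, hw'.1.trans hu'.2⟩
  · rintro ⟨h1, h2⟩
    exact le_antisymm (hle _ _ h2 hu) (hle _ _ h1 hw)

end DFS

/-! ### A machine program for depth-first search -/

namespace RAM

open DFS

/-- Link the edges by source: the array `H` receives the heads of the lists and the array `X` the
links. Register `1` holds the number `1` and register `11` the number of edges. -/
def buildLinks (S H X : ℕ) : Cmd :=
  .forLoop 20 11 21 <| .block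
    [.add 22 20 1, .load 23 S 22, .load 24 H 23, .store X 22 24, .store H 23 22]

theorem run_buildLinks {B M S H X : ℕ} {s : State} (hSH : S ≠ H) (hSX : S ≠ X) (hHX : H ≠ X)
    (h1 : s.reg 1 = 1) (hM : s.reg 11 = M) (hB : M + 1 < B) (hH : s.arr H = fun _ => 0) :
    Run B (buildLinks S H X) s (M * 9 + 3) fun s' =>
      Heads M (s.arr S) (s'.arr H) ∧ Linked M (s.arr S) (s'.arr X) := by
  refine (Run.forLoop (B := B) (k := 5) (N := M) (s₀ := s)
    (fun j s' => Heads j (s.arr S) (s'.arr H) ∧ Linked j (s.arr S) (s'.arr X))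
    (by decide) (by decide) (by decide) (by simp [Cmd.block, Cmd.WritesReg])
    (by simp [Cmd.block, Cmd.WritesReg]) hM hB (fun j s' v w h => h) ?_ ?_).mono (by omega)
    fun _ h => h
  · simp only [Heads, Linked, hH]
    exact ⟨fun u => ⟨le_rfl, by simp, by omega⟩, by omega⟩
  · rintro j hj s' ⟨hh, hl⟩ ha hi
    have hS : s'.arr S = s.arr S := ha.2 S (by simp [Cmd.forLoop, Cmd.block, Cmd.WritesArr, hSH, hSX])
    have hr1 : s'.reg 1 = 1 := by rw [ha.1 1 (by simp [Cmd.forLoop, Cmd.block, Cmd.WritesReg]), h1]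
    refine (Run.of_wp (R := fun t => Heads (j + 1) (s.arr S) (t.arr H) ∧
      Linked (j + 1) (s.arr S) (t.arr X)) ?_).mono le_rfl fun _ h => h
    simp only [Cmd.block, wp]
    refine ⟨by omega, ?_⟩
    simp only [State.setReg_reg, State.setReg_arr, State.setArr_reg, State.setArr_arr,
      Function.update_self, Function.update_of_ne hHX, Function.update_of_ne hHX.symm, hi, hr1, hS]
    simp only [ne_eq, Nat.reduceEqDiff, not_false_eq_true,
      Function.update_of_ne, Function.update_self]
    set σ := s.arr S
    set u := σ (j + 1) with hu
    constructor
    · intro v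
      by_cases hv : v = u
      · subst hv
        simp only [Function.update_self]
        exact ⟨le_rfl, fun _ => hu.symm, fun e _ he _ => he⟩
      · simp only [Function.update_of_ne hv]
        obtain ⟨h2, h3, h4⟩ := hh v
        refine ⟨by omega, h3, fun e he he' hev => ?_⟩
        by_cases hej : e = j + 1
        · subst hej; exact absurd hev.symm hv
        · exact h4 e he (by omega) hev
    · intro e he he'
      by_cases hej : e = j + 1
      · subst hej
        simp only [Function.update_self]
        obtain ⟨h2, h3, h4⟩ := hh u
        exact ⟨by omega, h3, fun e' h5 h6 h7 => h4 e' h5 (by omega) h7⟩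
      · simp only [Function.update_of_ne hej]
        exact hl e he (by omega)

/-- Visit node `reg 28` unless it has been visited: give it the label `reg 30` and push it onto the
stack, of which `reg 21` is the height. -/
def visit (b : ℕ) : Cmd := .block
  [.load 29 b 28, .ite 29 .skip (.block [.store b 28 30, .store (b + 4) 21 28, .add 21 21 1])]

/-- One step of depth-first search. If the stack is not empty, the next edge of its top is examined,
or the top is finished if there is no such edge; otherwise the next root is taken. Register `20`
holds the number of remaining roots, `21` the height of the stack and `22` the number of finished
nodes. At the end register `23` tells whether anything is left to do. -/
def dfsStep (G R b : ℕ) : Cmd := .block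
  [.ite 21
    (.block [.sub 24 21 1, .load 25 (b + 4) 24, .load 26 (b + 2) 25,
      .ite 26
        (.block [.load 27 (b + 3) 26, .store (b + 2) 25 27, .load 28 G 26, visit b])
        (.block [.store (b + 1) 22 25, .add 22 22 1, .move 21 24])])
    (.block [.move 30 20, .sub 20 20 1, .load 28 R 20, visit b]),
  .add 23 20 21]

/-- Depth-first search with sources `S`, targets `G` and roots `R`. The arrays from `b` on hold the
labels, the finished nodes, the heads, the links and the stack. Register `10` holds the number of
nodes and of roots, and register `11` the number of edges. -/
def search (S G R b : ℕ) : Cmd := .seq (buildLinks S (b + 2) (b + 3))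
  (.seq (.block [.move 20 10, .const 21 0, .const 22 0, .add 23 20 21]) (.loop 23 (dfsStep G R b)))

/-- The memory holds the configuration `c`. -/
structure Holds (b : ℕ) (c : Config) (s : State) : Prop where
  i : s.reg 20 = c.i
  sp : s.reg 21 = c.stk.length
  len : s.reg 22 = c.post.length
  labels : s.arr b = c.L
  heads : s.arr (b + 2) = c.H
  stk : StackRep (s.arr (b + 4)) c.stk
  post : StackRep (s.arr (b + 1)) c.post
  cur : c.stk ≠ [] → s.reg 30 = c.i + 1

/-- A bound on the number of steps that are left: each of them takes a root, examines an edge or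
finishes a node. -/
def potential (K M : ℕ) (S : ℕ → ℕ) (c : Config) : ℕ :=
  c.i + (rest M S c.H).card + (K - c.post.length)

/-- One step of the program is one step of the search: it takes a root, examines an edge or finishes
a node, and each of these lowers the potential. -/
theorem wp_dfsStep {B K M G R b : ℕ} {c : Config} {s : State} {σ γ ρ ξ : ℕ → ℕ}
    (hG : G < b) (hB : 2 * K + 2 < B) (h1 : s.reg 1 = 1) (hγ : s.arr G = γ)
    (hρ : s.arr R = ρ) (hξ : s.arr (b + 3) = ξ) (hX : Linked M σ ξ)
    (hγK : ∀ e, 1 ≤ e → e ≤ M → γ e < K) (hρK : ∀ j < K, ρ j < K)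
    (h : Inv K M σ γ ρ c) (hi : c.i ≤ K) (hroots : RootsDone K ρ c) (hc : Holds b c s)
    (hpos : c.i + c.stk.length ≠ 0) :
    wp B (dfsStep G R b) (fun s' => ∃ c', Inv K M σ γ ρ c' ∧ c'.i ≤ K ∧ RootsDone K ρ c' ∧
      Holds b c' s' ∧ s'.reg 23 = c'.i + c'.stk.length ∧
      potential K M σ c' < potential K M σ c) s := by
  have hGb : ∀ j, G ≠ b + j := fun j => by omega
  have hlen := h.length_le
  obtain ⟨hci, hsp, hq, hL, hH, hstk, hpost, hcur⟩ := hc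
  cases hs : c.stk with
  | nil =>
    have hi0 : c.i ≠ 0 := by simpa [hs] using hpos
    have hi1 : c.i - 1 + 1 = c.i := by omega
    have hnext := h.nextRoot hs
    have hpot : ∀ n : ℕ, c.i - 1 + n + (K - c.post.length) < c.i + n + (K - c.post.length) :=
      fun n => by omega
    simp only [hs, List.length_nil] at hsp
    have hdone : ∀ L : ℕ → ℕ, (∀ v, c.L v ≠ 0 → L v = c.L v) → c.i ≤ L (ρ (c.i - 1)) →
        ∀ j, c.i - 1 ≤ j → j < K → j + 1 ≤ L (ρ j) := by
      intro L hL hv j hj hjK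
      by_cases hje : j = c.i - 1
      · subst hje; omega
      · have := hroots j (by omega) hjK
        rw [hL _ (by omega)]
        exact this
    simp [dfsStep, visit, Cmd.block, wp, hsp, hci, hL, hρ, h1]
    refine ⟨fun hv => ⟨by omega, { c with i := c.i - 1 }, hnext, by simp only; omega, ?_, ?_,
      by simp [hs], hpot _⟩, fun hv => ⟨by omega, by omega,
        { c with i := c.i - 1, stk := ρ (c.i - 1) :: c.stk,
                 L := Function.update c.L (ρ (c.i - 1)) (c.i - 1 + 1) },
        hnext.push hv (hρK _ (by omega)) (by simp only; omega) .refl (by simp [hs]),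
        by simp only; omega, ?_, ?_, by simp [hs], hpot _⟩⟩
    · exact hdone _ (fun _ _ => rfl) ((Nat.le_succ _).trans (h.lab _ hv).1)
    · constructor <;> simp [hsp, hq, hs, hL, hH, hpost, StackRep]
    · refine hdone _ (fun v hv' => Function.update_of_ne ?_ _ _) ?_
      · rintro rfl; exact hv' hv
      · simp [hi1]
    · constructor <;> simp [hq, hs, hL, hH, hpost, StackRep, hi1]
  | cons u t =>
    simp only [hs, List.length_cons] at hsp
    have hu : s.arr (b + 4) t.length = u := by rw [hs] at hstk; exact hstk.1
    have ht : StackRep (s.arr (b + 4)) t := by rw [hs] at hstk; exact hstk.2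
    have hut : u ∈ c.stk := hs ▸ List.mem_cons_self
    have hcur' : s.reg 30 = c.i + 1 := hcur (by simp [hs])
    have hiK : c.i + 1 ≤ K := by
      have hLu := h.cur u hut
      have := (h.lab u (by omega)).2.1
      omega
    simp only [hs, List.length_cons] at hlen
    by_cases he : c.H u = 0
    · simp [dfsStep, visit, Cmd.block, wp, hsp, hq, hH, hu, he, h1]
      refine ⟨by omega, by omega, { c with stk := t, post := u :: c.post }, h.pop hs he, hi, hroots,
        ?_, by simp [hci], by simp only [potential, List.length_cons]; omega⟩
      constructor <;> simp [hcur', hci, hL, hH, ht, StackRep, hpost.update]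
    · have hM := (h.head u).1
      have hrest := h.card_rest_advance_lt hX he
      simp [dfsStep, visit, Cmd.block, wp, hsp, hq, hL, hH, hξ, hu, he, h1, hγ, hGb]
      refine ⟨fun hv => ⟨by omega, { c with H := Function.update c.H u (ξ (c.H u)) },
        h.advance hX hut he hv, hi, hroots, ?_, by simp [hci, hs],
        by simp only [potential]; omega⟩, fun hv => ⟨by omega, by omega,
          { c with stk := γ (c.H u) :: c.stk, L := Function.update c.L (γ (c.H u)) (c.i + 1),
                   H := Function.update c.H u (ξ (c.H u)) }, ?_, hi, ?_, ?_, by simp [hci, hs],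
          by simp only [potential]; omega⟩⟩
      · constructor <;> simp [hcur', hci, hs, hsp, hq, hL, hH, hpost, StackRep, hu, ht]
      · have hedge : Edge M σ γ u (γ (c.H u)) :=
          ⟨c.H u, by omega, hM, (h.head u).2 he, rfl⟩
        have hstk' : ∀ v ∈ c.stk, Relation.ReflTransGen (Edge M σ γ) v (γ (c.H u)) := by
          intro v hv
          have hch := h.chain
          rw [hs, List.pairwise_cons] at hch
          rw [hs, List.mem_cons] at hv
          rcases hv with rfl | hv
          · exact .single hedge
          · exact (hch.1 v hv).tail hedge
        have hroot : Relation.ReflTransGen (Edge M σ γ) (ρ c.i) (γ (c.H u)) := by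
          have hLu := h.cur u hut
          have := (h.lab u (by omega)).2.2
          rw [hLu] at this
          exact this.tail hedge
        exact (h.push hv (hγK _ (by omega) hM) hiK hroot hstk').advance hX
          (List.mem_cons_of_mem _ hut) he (by simp)
      · intro j hj hjK
        have := hroots j hj hjK
        have hne : ρ j ≠ γ (c.H u) := fun heq => by rw [heq, hv] at this; omega
        simpa only [Function.update_of_ne hne] using this
      · constructor <;>
          simp [hcur', hci, hs, hq, hL, hH, hpost, StackRep, hu, ht, StackRep.update]

/-- The program `search` computes a depth-first search. The time bound comes from the potential: it
starts at `2 K + M` at most, and each step of the search lowers it. -/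
theorem run_search {B K M S G R b : ℕ} {s : State} (hS : S < b) (hG : G < b) (hR : R < b)
    (hB : 2 * K + M + 2 < B) (h1 : s.reg 1 = 1) (hK : s.reg 10 = K) (hM : s.reg 11 = M)
    (hzero : ∀ a, b ≤ a → a < b + 5 → s.arr a = fun _ => 0)
    (hGK : ∀ e, 1 ≤ e → e ≤ M → s.arr G e < K) (hRK : ∀ j < K, s.arr R j < K) :
    Run B (search S G R b) s (60 * (K + M + 1)) fun s' => ∃ post,
      Result K M (s.arr S) (s.arr G) (s.arr R) (s'.arr b) post ∧
      StackRep (s'.arr (b + 1)) post := by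
  have hbuild := run_buildLinks (B := B) (S := S) (H := b + 2) (X := b + 3) (s := s) (by omega)
    (by omega) (by omega) h1 hM (by omega) (hzero _ (by omega) (by omega))
  refine (Run.seq hbuild (k₂ := 4 + ((2 * K + M) * 28 + 1)) fun s₁ hs₁ ha₁ => ?_).mono
    (by omega) fun _ h => h
  have wr : ∀ r, r < 20 → s₁.reg r = s.reg r := fun r hr => ha₁.1 r (by
    simp [buildLinks, Cmd.forLoop, Cmd.block, Cmd.WritesReg]; omega)
  have wa : ∀ a, a ≠ b + 2 → a ≠ b + 3 → s₁.arr a = s.arr a := fun a h2 h3 => ha₁.2 a (by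
    simp [buildLinks, Cmd.forLoop, Cmd.block, Cmd.WritesArr]; omega)
  have init : Run B (.block [.move 20 10, .const 21 0, .const 22 0, .add 23 20 21]) s₁ 4
      fun s₂ => Holds b ⟨K, [], [], fun _ => 0, s₁.arr (b + 2)⟩ s₂ ∧ s₂.reg 23 = K := by
    refine (Run.of_wp ?_)
    simp only [Cmd.block, wp]
    simp [wr 10 (by omega), hK]
    refine ⟨by omega, by omega, ?_⟩
    constructor <;> simp [StackRep, wa b (by omega) (by omega), hzero b le_rfl (by omega)]
  refine Run.seq init fun s₂ hs₂ ha₂ => ?_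
  have wr' : ∀ r, r < 20 → s₂.reg r = s.reg r := fun r hr => (ha₂.1 r (by
    simp [Cmd.block, Cmd.WritesReg]; omega)).trans (wr r hr)
  have wa' : ∀ a, s₂.arr a = s₁.arr a := fun a => ha₂.2 a (by simp [Cmd.block, Cmd.WritesArr])
  have hloop := Run.loop (B := B) (r := 23) (s₀ := s₂) (P := dfsStep G R b) (k := 27)
    (fun s' => ∃ c, Inv K M (s.arr S) (s.arr G) (s.arr R) c ∧ c.i ≤ K ∧
      RootsDone K (s.arr R) c ∧ Holds b c s' ∧ s'.reg 23 = c.i + c.stk.length)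
    (fun s' => s'.reg 20 + (rest M (s.arr S) (s'.arr (b + 2))).card + (K - s'.reg 22))
    ⟨_, Inv.init hs₁.1, le_rfl, fun j h1 h2 => absurd h1 (by simpa using h2), hs₂.1, hs₂.2⟩
    fun s₃ ⟨c, hinv, hi, hroots, hc, h23⟩ ha₃ hne => ?_
  · refine hloop.mono ?_ ?_
    · have := card_rest_le M (s.arr S) (s₂.arr (b + 2))
      have h20 : s₂.reg 20 = K := hs₂.1.i
      have : s₂.reg 20 + (rest M (s.arr S) (s₂.arr (b + 2))).card + (K - s₂.reg 22) ≤ 2 * K + M := by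
        omega
      have := Nat.mul_le_mul_right 28 this
      omega
    · rintro s₄ ⟨⟨c, hinv, hi, hroots, hc, h23⟩, h0⟩
      have hi0 : c.i = 0 := by omega
      have hs0 : c.stk = [] := List.length_eq_zero_iff.1 (by omega)
      exact ⟨c.post, hc.labels ▸ hinv.result hroots hi0 hs0, hc.post⟩
  · have hwa : ∀ a, a < b ∨ a = b + 3 → s₃.arr a = s₁.arr a := fun a ha => (ha₃.2 a (by
      simp [dfsStep, visit, Cmd.block, Cmd.WritesArr]; omega)).trans (wa' a)
    have hwr : s₃.reg 1 = 1 := by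
      rw [ha₃.1 1 (by simp [dfsStep, visit, Cmd.block, Cmd.WritesReg]), wr' 1 (by omega), h1]
    have hlt : ∀ a, a < b → s₃.arr a = s.arr a := fun a ha =>
      (hwa a (.inl ha)).trans (wa a (by omega) (by omega))
    refine (Run.of_wp (wp_dfsStep (M := M) hG (by omega) hwr (hlt G hG) (hlt R hR)
      (hwa (b + 3) (.inr rfl)) hs₁.2 hGK hRK hinv hi hroots hc (by omega))).mono ?_ ?_
    · simp [dfsStep, visit, Cmd.block, Cmd.cost]
    · rintro s₄ ⟨c', h1, h2, h3, h4, h5, h6⟩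
      refine ⟨⟨c', h1, h2, h3, h4, h5⟩, ?_⟩
      simp only [potential] at h6
      rw [h4.i, h4.heads, h4.len, hc.i, hc.heads, hc.len]
      exact h6

end RAM

/-! ### Iteration over triples -/

namespace RAM

/-- Three nested counting loops. The outer one runs up to `reg n₁`, the inner ones up to
`reg n₂`. -/
def Cmd.forLoop₃ (n₁ n₂ : ℕ) (P : Cmd) : Cmd :=
  .forLoop 20 n₁ 21 (.forLoop 30 n₂ 31 (.forLoop 32 n₂ 33 P))

theorem Agree.forLoop {i n t : ℕ} {P : Cmd} {s s' : State} (h : Agree P s s') :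
    Agree (.forLoop i n t P) s s' :=
  h.mono (fun _ h => .inr (.inl h)) fun _ h => .inr (.inl h)

theorem Run.forLoop₃ {B k n₁ n₂ X Y : ℕ} {P : Cmd} {s₀ : State} (I : ℕ → State → Prop)
    (hn₁ : n₁ < 20) (hn₂ : n₂ < 20) (hP : ∀ r, r < 20 ∨ r = 20 ∨ r = 30 ∨ r = 32 → ¬ P.WritesReg r)
    (hX : s₀.reg n₁ = X) (hY : s₀.reg n₂ = Y) (hXB : X + 1 < B) (hYB : Y + 1 < B)
    (hI : ∀ c s r v, r = 20 ∨ r = 21 ∨ 30 ≤ r ∧ r ≤ 33 → I c s → I c (s.setReg r v))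
    (h₀ : I 0 s₀)
    (step : ∀ x < X, ∀ y < Y, ∀ z < Y, ∀ s, I ((x * Y + y) * Y + z) s →
      Agree (.forLoop₃ n₁ n₂ P) s₀ s → s.reg 20 = x → s.reg 30 = y → s.reg 32 = z →
      Run B P s k (I ((x * Y + y) * Y + z + 1))) :
    Run B (.forLoop₃ n₁ n₂ P) s₀ (X * (Y * (Y * (k + 4) + 7) + 7) + 3) (I (X * Y * Y)) := by
  have hI2 : ∀ c s r v r' v', (r = 20 ∨ r = 21 ∨ 30 ≤ r ∧ r ≤ 33) →
      (r' = 20 ∨ r' = 21 ∨ 30 ≤ r' ∧ r' ≤ 33) → I c s → I c ((s.setReg r v).setReg r' v') :=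
    fun c s r v r' v' hr hr' h => hI _ _ _ _ hr' (hI _ _ _ _ hr h)
  refine (Run.forLoop (k := Y * (Y * (k + 4) + 7) + 3) (fun x => I (x * Y * Y)) (by omega)
    (by omega) (by omega) ?_ ?_ hX hXB (fun j s v w => hI2 _ _ _ _ _ _ (by omega) (by omega))
    (by simpa using h₀) fun x hx s₁ hs₁ ha₁ h20 => ?_).mono (le_of_eq (by ring)) fun _ h => h
  · have := hP 20 (by omega)
    simp [Cmd.forLoop, Cmd.WritesReg, this]
  · have := hP n₁ (by omega)
    simp [Cmd.forLoop, Cmd.WritesReg, this]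
    omega
  have wr₁ : ∀ r, r < 20 → s₁.reg r = s₀.reg r := fun r hr => ha₁.1 r (by
    have := hP r (by omega)
    simp [Cmd.forLoop, Cmd.WritesReg, this]
    omega)
  refine (Run.forLoop (k := Y * (k + 4) + 3) (fun y => I ((x * Y + y) * Y)) (by omega)
    (by omega) (by omega) ?_ ?_ ((wr₁ _ hn₂).trans hY) hYB
    (fun j s v w => hI2 _ _ _ _ _ _ (by omega) (by omega))
    (by simpa using hs₁) fun y hy s₂ hs₂ ha₂ h30 => ?_).mono (le_of_eq (by ring))
    fun s h => by
      rw [add_mul, one_mul]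
      exact h
  · have := hP 30 (by omega)
    simp [Cmd.forLoop, Cmd.WritesReg, this]
  · have := hP n₂ (by omega)
    simp [Cmd.forLoop, Cmd.WritesReg, this]
    omega
  have wr₂ : ∀ r, r < 20 ∨ r = 20 → s₂.reg r = s₁.reg r := fun r hr => ha₂.1 r (by
    have := hP r (by omega)
    simp [Cmd.forLoop, Cmd.WritesReg, this]
    omega)
  refine (Run.forLoop (k := k) (fun z => I ((x * Y + y) * Y + z)) (by omega)
    (by omega) (by omega) (hP _ (by omega)) (hP _ (by omega))
    ((wr₂ _ (by omega)).trans ((wr₁ _ hn₂).trans hY)) hYB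
    (fun j s v w => hI2 _ _ _ _ _ _ (by omega) (by omega))
    (by simpa using hs₂) fun z hz s₃ hs₃ ha₃ h32 => ?_).mono le_rfl
    fun s h => by
      rw [← add_assoc, add_mul, one_mul]
      exact h
  have wr₃ : ∀ r, r = 20 ∨ r = 30 → s₃.reg r = s₂.reg r := fun r hr => ha₃.1 r (by
    have := hP r (by omega)
    simp [Cmd.forLoop, Cmd.WritesReg, this]
    omega)
  exact step x hx y hy z hz s₃ hs₃ (ha₁.trans (ha₂.forLoop.trans ha₃.forLoop.forLoop))
    ((wr₃ 20 (by omega)).trans ((wr₂ 20 (by omega)).trans h20))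
    ((wr₃ 30 (by omega)).trans h30) h32

theorem triple_inj {Y x y z x' y' z' : ℕ} (hy : y < Y) (hz : z < Y) (hy' : y' < Y) (hz' : z' < Y)
    (h : (x * Y + y) * Y + z = (x' * Y + y') * Y + z') : x = x' ∧ y = y' ∧ z = z' := by
  have key : ∀ {a b a' b' : ℕ}, b < Y → b' < Y → a * Y + b = a' * Y + b' → a = a' ∧ b = b' := by
    intro a b a' b' hb hb' h
    have hpos : 0 < Y := by omega
    have h1 := congrArg (· / Y) h
    have h2 := congrArg (· % Y) h
    simp only [Nat.mul_comm _ Y, Nat.mul_add_div hpos, Nat.mul_add_mod, Nat.div_eq_of_lt hb,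
      Nat.div_eq_of_lt hb', Nat.mod_eq_of_lt hb, Nat.mod_eq_of_lt hb'] at h1 h2
    exact ⟨h1, h2⟩
  obtain ⟨h1, h2⟩ := key hz hz' h
  obtain ⟨h3, h4⟩ := key hy hy' h1
  exact ⟨h3, h4, h2⟩

theorem triple_lt {X Y x y z : ℕ} (hx : x < X) (hy : y < Y) (hz : z < Y) :
    (x * Y + y) * Y + z < X * Y * Y := by
  have h1 : x * Y + y + 1 ≤ X * Y := by
    have := Nat.mul_le_mul_right Y hx
    rw [Nat.succ_mul] at this
    omega
  have := Nat.mul_le_mul_right Y h1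
  rw [Nat.succ_mul] at this
  omega

theorem exists_triple {X Y c : ℕ} (hc : c < X * Y * Y) :
    ∃ x < X, ∃ y < Y, ∃ z < Y, c = (x * Y + y) * Y + z := by
  have hY : 0 < Y := Nat.pos_of_ne_zero (by rintro rfl; simp at hc)
  have h1 : c / Y < X * Y := Nat.div_lt_of_lt_mul (by rwa [mul_comm Y])
  exact ⟨c / Y / Y, Nat.div_lt_of_lt_mul (by rwa [mul_comm Y]), c / Y % Y, Nat.mod_lt _ hY, c % Y,
    Nat.mod_lt _ hY, by rw [Nat.div_add_mod', Nat.div_add_mod']⟩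

/-! ### Reading the input -/

/-- The constants that the program computes first, for a transducer with `m` states and `L`
transitions and an automaton with `n` states and `k` transitions. Register `8` counts the moves of
the automaton, including those on the empty word, register `10` the nodes of the product graph and
register `11` its edges. -/
structure Regs (m L n k : ℕ) (s : State) : Prop where
  r1 : s.reg 1 = 1
  r2 : s.reg 2 = m
  r3 : s.reg 3 = L
  r4 : s.reg 4 = 2 + 2 * m
  r6 : s.reg 6 = n
  r7 : s.reg 7 = k
  r8 : s.reg 8 = n + k
  r9 : s.reg 9 = 4 + 2 * m + 4 * L + 2 * n
  r10 : s.reg 10 = m * n * n + 1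
  r11 : s.reg 11 = L * (n + k) * (n + k)
  r12 : s.reg 12 = 2
  r13 : s.reg 13 = 2 + m
  r14 : s.reg 14 = 4 + 2 * m + 4 * L
  r15 : s.reg 15 = 4 + 2 * m + 4 * L + n
  r16 : s.reg 16 = 3
  r17 : s.reg 17 = 4

theorem Regs.congr {m L n k : ℕ} {s s' : State} (h : Regs m L n k s)
    (hs : ∀ r < 20, s'.reg r = s.reg r) : Regs m L n k s' := by
  constructor <;> (rw [hs _ (by omega)]; first
    | exact h.r1 | exact h.r2 | exact h.r3 | exact h.r4 | exact h.r6 | exact h.r7 | exact h.r8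
    | exact h.r9 | exact h.r10 | exact h.r11 | exact h.r12 | exact h.r13 | exact h.r14
    | exact h.r15 | exact h.r16 | exact h.r17)

/-- Compute the constants. -/
def setup : Cmd := .block
  [.const 1 1, .const 12 2, .const 16 3, .const 17 4, .load 2 0 0, .load 3 0 1, .add 13 12 2,
    .add 4 13 2, .mul 5 17 3, .add 5 4 5, .load 6 0 5, .add 20 5 1, .load 7 0 20, .add 8 6 7,
    .add 14 5 12, .add 15 14 6, .add 9 15 6, .mul 10 2 6, .mul 10 10 6, .add 10 10 1,
    .mul 11 3 8, .mul 11 11 8]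

/-- The input word `w` has the right dimensions and the word bound `B` is large enough. -/
structure Input (B m L n k : ℕ) (w : ℕ → ℕ) : Prop where
  m_pos : 0 < m
  n_pos : 0 < n
  w0 : w 0 = m
  w1 : w 1 = L
  wn : w (2 + 2 * m + 4 * L) = n
  wk : w (3 + 2 * m + 4 * L) = k
  src : ∀ t < L, w (2 + 2 * m + 4 * t) < m
  tgt : ∀ t < L, w (2 + 2 * m + 4 * t + 3) < m
  moveSrc : ∀ i < k, w (4 + 2 * m + 4 * L + 2 * n + 3 * i) < n
  moveTgt : ∀ i < k, w (4 + 2 * m + 4 * L + 2 * n + 3 * i + 2) < n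
  bound : 2 * (m * n * n + 1) + L * (n + k) * (n + k) + (2 * m + 4 * L + 2 * n + 3 * k) + 20 < B

variable {B m L n k : ℕ} {w : ℕ → ℕ} {s : State}

theorem run_setup (hw : Input B m L n k w) (hr : ∀ r, s.reg r = 0) (h0 : s.arr 0 = w) :
    Run B setup s 22 (Regs m L n k) := by
  have h1 := hw.bound
  have h2 : m * n ≤ m * n * n := Nat.le_mul_of_pos_right _ hw.n_pos
  have h3 : L * (n + k) ≤ L * (n + k) * (n + k) :=
    Nat.le_mul_of_pos_right _ (Nat.add_pos_left hw.n_pos _)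
  have e1 : 2 + m + m + 4 * L = 2 + 2 * m + 4 * L := by ring
  have e2 : 2 + 2 * m + 4 * L + 1 = 3 + 2 * m + 4 * L := by ring
  refine Run.of_wp ?_
  simp [setup, Cmd.block, wp, hr, h0, hw.w0, hw.w1, e1, e2, hw.wn, hw.wk]
  refine ⟨by omega, by omega, by omega, by omega, by omega, by omega, by omega, by omega, by omega,
    by omega, by omega, by omega, by omega, by omega, by omega, by omega, by omega, by omega, ?_⟩
  constructor <;> simp <;> omega

/-! ### The moves of the automaton -/

/-- List the moves of the automaton: first those on the empty word, then its transitions. The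
arrays `1`, `2` and `3` receive the source, the label and the target. -/
def listMoves : Cmd := .seq
  (.forLoop 20 6 21 (.block [.store 1 20 20, .store 3 20 20]))
  (.forLoop 20 7 21 (.block [.mul 22 16 20, .add 22 22 9, .load 23 0 22, .add 24 6 20,
    .store 1 24 23, .add 22 22 1, .load 23 0 22, .store 2 24 23, .add 22 22 1, .load 23 0 22,
    .store 3 24 23]))

/-- The arrays `1`, `2` and `3` hold the moves of the automaton. -/
structure Moves (m L n k : ℕ) (w : ℕ → ℕ) (s : State) : Prop where
  eps : ∀ i < n, s.arr 1 i = i ∧ s.arr 2 i = 0 ∧ s.arr 3 i = i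
  sym : ∀ i < k, s.arr 1 (n + i) = w (4 + 2 * m + 4 * L + 2 * n + 3 * i) ∧
    s.arr 2 (n + i) = w (4 + 2 * m + 4 * L + 2 * n + 3 * i + 1) ∧
    s.arr 3 (n + i) = w (4 + 2 * m + 4 * L + 2 * n + 3 * i + 2)

theorem Moves.lt (hw : Input B m L n k w) (h : Moves m L n k w s) {i : ℕ} (hi : i < n + k) :
    s.arr 1 i < n ∧ s.arr 3 i < n := by
  by_cases hin : i < n
  · rw [(h.eps i hin).1, (h.eps i hin).2.2]
    exact ⟨hin, hin⟩
  · obtain ⟨j, rfl⟩ := Nat.exists_eq_add_of_le (not_lt.1 hin)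
    have hj : j < k := by omega
    rw [(h.sym j hj).1, (h.sym j hj).2.2]
    exact ⟨hw.moveSrc j hj, hw.moveTgt j hj⟩

theorem run_listMoves (hw : Input B m L n k w) (hr : Regs m L n k s) (h0 : s.arr 0 = w)
    (hz : s.arr 2 = fun _ => 0) : Run B listMoves s (15 * (n + k) + 6) (Moves m L n k w) := by
  have hb := hw.bound
  have hfst := Run.forLoop (B := B) (k := 2) (i := 20) (n := 6) (t := 21) (N := n) (s₀ := s)
    (P := .block [.store 1 20 20, .store 3 20 20])
    (fun j s => ∀ i < j, s.arr 1 i = i ∧ s.arr 3 i = i) (by decide) (by decide) (by decide)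
    (by simp [Cmd.block, Cmd.WritesReg]) (by simp [Cmd.block, Cmd.WritesReg]) hr.r6 (by omega)
    (fun j s v w h => h) (by simp) fun j hj s' hs' ha hi => Run.of_wp (by
      simp only [Cmd.block, wp, State.setArr_arr, State.setArr_reg, hi]
      intro i hij
      by_cases he : i = j
      · subst he; simp
      · simpa [he] using hs' i (by omega))
  refine (Run.seq hfst (k₂ := k * 15 + 3) (R' := Moves m L n k w) fun s₁ hs₁ ha₁ => ?_).mono
    (by omega) fun _ h => h
  have hr₁ : Regs m L n k s₁ := hr.congr fun r hr => ha₁.1 r (by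
    simp [Cmd.forLoop, Cmd.block, Cmd.WritesReg]; omega)
  have h0₁ : s₁.arr 0 = w := (ha₁.2 0 (by simp [Cmd.forLoop, Cmd.block, Cmd.WritesArr])).trans h0
  have hz₁ : s₁.arr 2 = fun _ => 0 :=
    (ha₁.2 2 (by simp [Cmd.forLoop, Cmd.block, Cmd.WritesArr])).trans hz
  refine (Run.forLoop (B := B) (k := 11) (N := k)
    (fun j s => (∀ i < n, s.arr 1 i = i ∧ s.arr 2 i = 0 ∧ s.arr 3 i = i) ∧ ∀ i < j,
      s.arr 1 (n + i) = w (4 + 2 * m + 4 * L + 2 * n + 3 * i) ∧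
      s.arr 2 (n + i) = w (4 + 2 * m + 4 * L + 2 * n + 3 * i + 1) ∧
      s.arr 3 (n + i) = w (4 + 2 * m + 4 * L + 2 * n + 3 * i + 2)) (by decide) (by decide)
    (by decide) (by simp [Cmd.block, Cmd.WritesReg]) (by simp [Cmd.block, Cmd.WritesReg]) hr₁.r7
    (by omega) (fun j s v w h => h) ⟨fun i hi => ⟨(hs₁ i hi).1, by rw [hz₁], (hs₁ i hi).2⟩,
      by omega⟩ fun j hj s' hs' ha hi => Run.of_wp ?_).mono le_rfl fun _ h => ⟨h.1, h.2⟩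
  have hr' : Regs m L n k s' := hr₁.congr fun r hr => ha.1 r (by
    simp [Cmd.forLoop, Cmd.block, Cmd.WritesReg]; omega)
  have h0' : s'.arr 0 = w := (ha.2 0 (by simp [Cmd.forLoop, Cmd.block, Cmd.WritesArr])).trans h0₁
  simp [Cmd.block, wp, hi, hr'.r16, hr'.r9, hr'.r6, hr'.r1, h0']
  refine ⟨by omega, by omega, by omega, by omega, by omega, fun i hin => ?_, fun i hij => ?_⟩
  · simpa [show i ≠ n + j by omega] using hs'.1 i hin
  · by_cases he : i = j
    · subst he
      simp [add_assoc]
      exact ⟨congrArg w (by omega), congrArg w (by omega), congrArg w (by omega)⟩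
    · simpa [he] using hs'.2 i (by omega)

end RAM

namespace RAM

variable {B m L n k : ℕ} {w : ℕ → ℕ} {s : State}

/-! ### The product graph -/

/-- The number of the node `(p, r, t)` of the product graph. The number `0` is left for a dummy
node. -/
def node (n p r t : ℕ) : ℕ := (p * n + r) * n + t + 1

theorem node_le {p r t : ℕ} (hp : p < m) (hr : r < n) (ht : t < n) : node n p r t ≤ m * n * n :=
  triple_lt hp hr ht

/-- List the edges of the product graph, one for each transition of the transducer, move on the
input and move on the output; if the labels do not match, it is a loop at the dummy node. The
arrays `4` and `5` receive sources and targets. Array `6` receives the target if the input label is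
empty and the source otherwise, and array `7` receives the output label if the input label is
empty. -/
def listEdges : Cmd := .seq (.const 34 0) <| .forLoop₃ 3 8 <| .block
  [.add 34 34 1, .mul 22 17 20, .add 22 22 4, .load 23 0 22, .add 22 22 1, .load 24 0 22,
    .add 22 22 1, .load 25 0 22, .add 22 22 1, .load 26 0 22, .load 27 2 30, .load 28 2 32,
    .sub 29 24 27, .ite 29 .skip <| .block [.sub 29 27 24, .ite 29 .skip <| .block
      [.sub 29 25 28, .ite 29 .skip <| .block [.sub 29 28 25, .ite 29 .skip <| .block
        [.load 35 1 30, .load 36 1 32, .mul 37 23 6, .add 37 37 35, .mul 37 37 6, .add 37 37 36,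
          .add 37 37 1, .store 4 34 37,
          .load 35 3 30, .load 36 3 32, .mul 38 26 6, .add 38 38 35, .mul 38 38 6, .add 38 38 36,
          .add 38 38 1, .store 5 34 38,
          .ite 24 (.store 6 34 37) (.block [.store 6 34 38, .store 7 34 25])]]]]]

/-- The entries of the arrays `4`, `5`, `6` and `7` at `e` are those of transition `t` with the
moves `i` and `j`. -/
def EdgeAt (m : ℕ) (n : ℕ) (w : ℕ → ℕ) (s : State) (t i j e : ℕ) : Prop :=
  if w (2 + 2 * m + 4 * t + 1) = s.arr 2 i ∧ w (2 + 2 * m + 4 * t + 2) = s.arr 2 j then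
    s.arr 4 e = node n (w (2 + 2 * m + 4 * t)) (s.arr 1 i) (s.arr 1 j) ∧
    s.arr 5 e = node n (w (2 + 2 * m + 4 * t + 3)) (s.arr 3 i) (s.arr 3 j) ∧
    s.arr 6 e = (if w (2 + 2 * m + 4 * t + 1) = 0 then s.arr 5 e else s.arr 4 e) ∧
    s.arr 7 e = if w (2 + 2 * m + 4 * t + 1) = 0 then w (2 + 2 * m + 4 * t + 2) else 0
  else s.arr 4 e = 0 ∧ s.arr 5 e = 0 ∧ s.arr 6 e = 0 ∧ s.arr 7 e = 0

theorem EdgeAt.congr {s' : State} {t i j e : ℕ} (h : EdgeAt m n w s t i j e)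
    (h123 : ∀ a, a = 1 ∨ a = 2 ∨ a = 3 → s'.arr a = s.arr a)
    (h4567 : ∀ a, 4 ≤ a ∧ a ≤ 7 → s'.arr a e = s.arr a e) : EdgeAt m n w s' t i j e := by
  simpa only [EdgeAt, h123 1 (by omega), h123 2 (by omega), h123 3 (by omega),
    h4567 4 (by omega), h4567 5 (by omega), h4567 6 (by omega), h4567 7 (by omega)] using h

/-- The arrays from `4` to `7` hold the edges of the product graph. -/
def Edges (m L n k : ℕ) (w : ℕ → ℕ) (s : State) : Prop :=
  ∀ t < L, ∀ i < n + k, ∀ j < n + k,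
    EdgeAt m n w s t i j ((t * (n + k) + i) * (n + k) + j + 1)

theorem run_listEdges (hw : Input B m L n k w) (hr : Regs m L n k s) (h0 : s.arr 0 = w)
    (hmv : Moves m L n k w s) (hz : ∀ a, 4 ≤ a ∧ a ≤ 7 → s.arr a = fun _ => 0) :
    Run B listEdges s (100 * ((L * (n + k) + L) * (n + k) + L + 1)) (Edges m L n k w) := by
  have hb := hw.bound
  have h3 : L * (n + k) ≤ L * (n + k) * (n + k) :=
    Nat.le_mul_of_pos_right _ (Nat.add_pos_left hw.n_pos _)
  have h4 : L ≤ L * (n + k) := Nat.le_mul_of_pos_right _ (Nat.add_pos_left hw.n_pos _)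
  have hcost : L * ((n + k) * ((n + k) * (50 + 4) + 7) + 7) + 3 + 1 ≤
      100 * ((L * (n + k) + L) * (n + k) + L + 1) := by
    nlinarith
  have hinit : Run B (.const 34 0) s 1 fun s₁ => s₁.reg 34 = 0 := Run.of_wp (by simp [wp]; omega)
  refine (Run.seq hinit (k₂ := L * ((n + k) * ((n + k) * (50 + 4) + 7) + 7) + 3)
    (R' := Edges m L n k w) fun s₁ hs₁ ha₁ => ?_).mono (by omega) fun _ h => h
  have hr₁ : Regs m L n k s₁ := hr.congr fun r hr => ha₁.1 r (by simp [Cmd.WritesReg]; omega)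
  have ha₁' : ∀ a, s₁.arr a = s.arr a := fun a => ha₁.2 a (by simp [Cmd.WritesArr])
  have hmv₁ : Moves m L n k w s₁ := ⟨by simpa only [ha₁'] using hmv.eps,
    by simpa only [ha₁'] using hmv.sym⟩
  refine (Run.forLoop₃ (k := 50) (X := L) (Y := n + k)
    (fun c s => s.reg 34 = c ∧ (∀ a, 4 ≤ a ∧ a ≤ 7 → ∀ e, c < e → s.arr a e = 0) ∧
      ∀ t < L, ∀ i < n + k, ∀ j < n + k, (t * (n + k) + i) * (n + k) + j + 1 ≤ c →
        EdgeAt m n w s t i j ((t * (n + k) + i) * (n + k) + j + 1))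
    (by omega) (by omega) ?_ hr₁.r3 hr₁.r8 (by omega) (by omega) ?_ ?_ ?_).mono le_rfl ?_
  · intro r hr
    simp [Cmd.block, Cmd.WritesReg]
    omega
  · rintro c s r v hr ⟨h1, h2⟩
    exact ⟨by simp [show 34 ≠ r by omega, h1], h2⟩
  · refine ⟨hs₁, fun a ha e _ => by rw [ha₁', hz a ha], by omega⟩
  · rintro t ht i hi j hj s₂ ⟨hc, hfresh, hpos⟩ ha₂ h20 h30 h32
    have hr₂ : Regs m L n k s₂ := hr₁.congr fun r hr => ha₂.1 r (by
      simp [Cmd.forLoop₃, Cmd.forLoop, Cmd.block, Cmd.WritesReg]; omega)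
    have ha₂' : ∀ a, a < 4 → s₂.arr a = s₁.arr a := fun a ha => ha₂.2 a (by
      simp [Cmd.forLoop₃, Cmd.forLoop, Cmd.block, Cmd.WritesArr]; omega)
    have h0₂ : s₂.arr 0 = w := (ha₂' 0 (by omega)).trans ((ha₁' 0).trans h0)
    have hmv₂ : Moves m L n k w s₂ := ⟨by
      simpa only [ha₂' 1 (by omega), ha₂' 2 (by omega), ha₂' 3 (by omega)] using hmv₁.eps, by
      simpa only [ha₂' 1 (by omega), ha₂' 2 (by omega), ha₂' 3 (by omega)] using hmv₁.sym⟩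
    have hlt := triple_lt ht hi hj
    set e := (t * (n + k) + i) * (n + k) + j with he
    refine (Run.of_wp (R := fun s' => s'.reg 34 = e + 1 ∧ EdgeAt m n w s' t i j (e + 1) ∧
      ∀ a, 4 ≤ a ∧ a ≤ 7 → ∀ x, x ≠ e + 1 → s'.arr a x = s₂.arr a x) ?_).frame.mono
      (by simp [Cmd.block, Cmd.cost]) ?_
    · have hu := node_le (hw.src t ht) (hmv₂.lt hw hi).1 (hmv₂.lt hw hj).1
      have hv := node_le (hw.tgt t ht) (hmv₂.lt hw hi).2 (hmv₂.lt hw hj).2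
      have hn := hw.n_pos
      set A := 2 + 2 * m + 4 * t with hA
      have e1 : 4 * t + (2 + 2 * m) = A := by ring
      have e2 : A + 1 + 1 = A + 2 := rfl
      have e3 : A + 2 + 1 = A + 3 := rfl
      have hb₁ : 4 * t < B := by omega
      have hb₂ : A + 3 < B := by omega
      have hb₃ : e + 1 < B := by omega
      have hnode : ∀ p r t, node n p r t < B → p * n < B ∧ p * n + r < B ∧ (p * n + r) * n < B ∧
          (p * n + r) * n + t < B ∧ (p * n + r) * n + t + 1 < B := by
        intro p r t h
        have : p * n + r ≤ (p * n + r) * n := Nat.le_mul_of_pos_right _ hn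
        unfold node at h
        refine ⟨?_, ?_, ?_, ?_, ?_⟩ <;> omega
      obtain ⟨u1, u2, u3, u4, u5⟩ := hnode _ _ _ (hu.trans_lt (by omega))
      obtain ⟨v1, v2, v3, v4, v5⟩ := hnode _ _ _ (hv.trans_lt (by omega))
      have hz4 := hfresh 4 (by omega) (e + 1) (by omega)
      have hz5 := hfresh 5 (by omega) (e + 1) (by omega)
      have hz6 := hfresh 6 (by omega) (e + 1) (by omega)
      have hz7 := hfresh 7 (by omega) (e + 1) (by omega)
      have hb₄ : A < B := by omega
      have hb₅ : A + 1 < B := by omega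
      have hb₆ : A + 2 < B := by omega
      by_cases c1 : w (A + 1) = s₂.arr 2 i
      · by_cases c2 : w (A + 2) = s₂.arr 2 j
        · by_cases c0 : s₂.arr 2 i = 0 <;>
          · simp [Cmd.block, wp, hc, h20, h30, h32, hr₂.r1, hr₂.r4, hr₂.r6, hr₂.r17,
            h0₂, e1, e2, e3, EdgeAt, ← hA, hb₁, hb₂, hb₃, hb₄, hb₅, hb₆, node,
              c1, c2, c0, u1, u2, u3, u4, u5, v1, v2, v3, v4, v5, hz7]
            intro a h1 h2 x hx
            interval_cases a <;> simp [hx]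
        · rcases Nat.lt_or_gt_of_ne c2 with c | c <;>
          · simp [Cmd.block, wp, hc, h20, h30, h32, hr₂.r1, hr₂.r4, hr₂.r6, hr₂.r17,
            h0₂, e1, e2, e3, EdgeAt, ← hA, hb₁, hb₂, hb₃, hb₄, hb₅, hb₆,
              c1, c2, c.le, hz4, hz5, hz6, hz7]
            omega
      · rcases Nat.lt_or_gt_of_ne c1 with c | c <;>
        · simp [Cmd.block, wp, hc, h20, h30, h32, hr₂.r1, hr₂.r4, hr₂.r6, hr₂.r17,
            h0₂, e1, e2, e3, EdgeAt, ← hA, hb₁, hb₂, hb₃, hb₄, hb₅, hb₆,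
            c1, c.le, hz4, hz5, hz6, hz7]
          omega
    · rintro s₃ ⟨⟨h34, hedge, hold⟩, ha₃⟩
      have ha₃' : ∀ a, a < 4 → s₃.arr a = s₂.arr a := fun a ha => ha₃.2 a (by
        simp [Cmd.block, Cmd.WritesArr]; omega)
      refine ⟨h34, fun a ha x hx => ?_, fun t' ht' i' hi' j' hj' hle => ?_⟩
      · rw [hold a ha x (by omega)]
        exact hfresh a ha x (by omega)
      · by_cases heq : (t' * (n + k) + i') * (n + k) + j' = e
        · obtain ⟨rfl, rfl, rfl⟩ := triple_inj hi' hj' hi hj heq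
          exact hedge
        · exact (hpos t' ht' i' hi' j' hj' (by omega)).congr (fun a ha => ha₃' a (by omega))
            fun a ha => hold a ha _ (by omega)
  · rintro s' ⟨-, -, h2⟩ t ht i hi j hj
    exact h2 t ht i hi j hj (triple_lt ht hi hj)

/-- The arrays `8`, `9` and `10` hold the initial, the final and all nodes, each at its own number,
and `0` elsewhere. -/
structure Nodes (m L n : ℕ) (w : ℕ → ℕ) (s : State) : Prop where
  zero : s.arr 8 0 = 0 ∧ s.arr 9 0 = 0 ∧ s.arr 10 0 = 0
  pos : ∀ p < m, ∀ r < n, ∀ t < n,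
    s.arr 8 (node n p r t) = (if w (2 + p) ≠ 0 ∧ w (4 + 2 * m + 4 * L + r) ≠ 0 ∧
      w (4 + 2 * m + 4 * L + t) ≠ 0 then node n p r t else 0) ∧
    s.arr 9 (node n p r t) = (if w (2 + m + p) ≠ 0 ∧ w (4 + 2 * m + 4 * L + n + r) ≠ 0 ∧
      w (4 + 2 * m + 4 * L + n + t) ≠ 0 then node n p r t else 0) ∧
    s.arr 10 (node n p r t) = node n p r t

/-- Store the number `reg 34` of the current node into array `a` if all its components are flagged
in the input. Registers `f` and `g` hold the addresses of the flags. -/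
def markNode (a f g : ℕ) : Cmd := .block
  [.add 22 f 20, .load 23 0 22, .add 22 g 30, .load 24 0 22, .add 22 g 32, .load 25 0 22,
    .ite 23 (.ite 24 (.ite 25 (.store a 34 34) .skip) .skip) .skip]

theorem run_markNode {a f g : ℕ} (hg : g < 20) (h1 : s.reg f + s.reg 20 < B)
    (h2 : s.reg g + s.reg 30 < B) (h3 : s.reg g + s.reg 32 < B) :
    Run B (markNode a f g) s 13 fun s' => ∀ x, s'.arr a x =
      if x = s.reg 34 ∧ s.arr 0 (s.reg f + s.reg 20) ≠ 0 ∧ s.arr 0 (s.reg g + s.reg 30) ≠ 0 ∧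
        s.arr 0 (s.reg g + s.reg 32) ≠ 0 then s.reg 34 else s.arr a x := by
  refine (Run.of_wp (R := fun s' => ∀ x, s'.arr a x = _) ?_).mono
    (by simp [markNode, Cmd.block, Cmd.cost]) fun s' h => h
  have e2 : ∀ r, 20 ≤ r → g ≠ r := fun r hr => by omega
  by_cases c1 : s.arr 0 (s.reg f + s.reg 20) = 0
  · simp [markNode, Cmd.block, wp, e2, h1, h2, h3, c1]
  by_cases c2 : s.arr 0 (s.reg g + s.reg 30) = 0
  · simp [markNode, Cmd.block, wp, e2, h1, h2, h3, c1, c2]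
  by_cases c3 : s.arr 0 (s.reg g + s.reg 32) = 0
  · simp [markNode, Cmd.block, wp, e2, h1, h2, h3, c1, c2, c3]
  · simp [markNode, Cmd.block, wp, e2, h1, h2, h3, c1, c2, c3, Function.update_apply]

/-- List the nodes of the product graph. -/
def listNodes : Cmd := .seq (.const 34 0) <| .forLoop₃ 2 6 <|
  .seq (.block [.add 34 34 1, .store 10 34 34]) (.seq (markNode 8 12 14) (markNode 9 13 15))

theorem run_listNodes (hw : Input B m L n k w) (hr : Regs m L n k s) (h0 : s.arr 0 = w)
    (hz : ∀ a, 8 ≤ a ∧ a ≤ 10 → s.arr a = fun _ => 0) :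
    Run B listNodes s (100 * ((m * n + m) * n + m + 1)) (Nodes m L n w) := by
  have hb := hw.bound
  have h2 : m * n ≤ m * n * n := Nat.le_mul_of_pos_right _ hw.n_pos
  have h4 : m ≤ m * n := Nat.le_mul_of_pos_right _ hw.n_pos
  have hcost : m * (n * (n * (28 + 4) + 7) + 7) + 3 + 1 ≤ 100 * ((m * n + m) * n + m + 1) := by
    nlinarith
  have hinit : Run B (.const 34 0) s 1 fun s₁ => s₁.reg 34 = 0 := Run.of_wp (by simp [wp]; omega)
  refine (Run.seq hinit (k₂ := m * (n * (n * (28 + 4) + 7) + 7) + 3) (R' := Nodes m L n w)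
    fun s₁ hs₁ ha₁ => ?_).mono (by omega) fun _ h => h
  have hr₁ : Regs m L n k s₁ := hr.congr fun r hr => ha₁.1 r (by simp [Cmd.WritesReg]; omega)
  have ha₁' : ∀ a, s₁.arr a = s.arr a := fun a => ha₁.2 a (by simp [Cmd.WritesArr])
  refine (Run.forLoop₃ (k := 28) (X := m) (Y := n)
    (fun c s => s.reg 34 = c ∧ (s.arr 8 0 = 0 ∧ s.arr 9 0 = 0 ∧ s.arr 10 0 = 0) ∧
      (∀ v, c < v → s.arr 8 v = 0 ∧ s.arr 9 v = 0) ∧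
      ∀ p < m, ∀ r < n, ∀ t < n, node n p r t ≤ c →
      s.arr 8 (node n p r t) = (if w (2 + p) ≠ 0 ∧ w (4 + 2 * m + 4 * L + r) ≠ 0 ∧
        w (4 + 2 * m + 4 * L + t) ≠ 0 then node n p r t else 0) ∧
      s.arr 9 (node n p r t) = (if w (2 + m + p) ≠ 0 ∧ w (4 + 2 * m + 4 * L + n + r) ≠ 0 ∧
        w (4 + 2 * m + 4 * L + n + t) ≠ 0 then node n p r t else 0) ∧
      s.arr 10 (node n p r t) = node n p r t)
    (by omega) (by omega) ?_ hr₁.r2 hr₁.r6 (by omega) (by omega) ?_ ?_ ?_).mono le_rfl ?_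
  · intro r hr
    simp [markNode, Cmd.block, Cmd.WritesReg]
    omega
  · rintro c s r v hr ⟨h1, h2⟩
    exact ⟨by simp [show 34 ≠ r by omega, h1], h2⟩
  · simp [hs₁, ha₁', hz, node]
  · rintro p hp r hr t ht s₂ ⟨hc, hzero, hfresh, hpos⟩ ha₂ h20 h30 h32
    have hr₂ : Regs m L n k s₂ := hr₁.congr fun r hr => ha₂.1 r (by
      simp [Cmd.forLoop₃, Cmd.forLoop, markNode, Cmd.block, Cmd.WritesReg]; omega)
    have h0₂ : s₂.arr 0 = w := (ha₂.2 0 (by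
      simp [Cmd.forLoop₃, Cmd.forLoop, markNode, Cmd.block, Cmd.WritesArr])).trans ((ha₁' 0).trans h0)
    have hlt := triple_lt hp hr ht
    have hhead : Run B (.block [.add 34 34 1, .store 10 34 34]) s₂ 2 fun s' =>
        s'.reg 34 = node n p r t ∧ s'.arr 10 =
          Function.update (s₂.arr 10) (node n p r t) (node n p r t) := Run.of_wp (by
      simp [Cmd.block, wp, hc, hr₂.r1, node]
      omega)
    refine (Run.seq hhead (k₂ := 26) fun s₃ hs₃ ha₃ => ?_).mono le_rfl fun _ h => h
    have wr₃ : ∀ r, r ≠ 34 → s₃.reg r = s₂.reg r := fun r hr => ha₃.1 r (by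
      simp [Cmd.block, Cmd.WritesReg, hr])
    have wa₃ : ∀ a, a ≠ 10 → s₃.arr a = s₂.arr a := fun a ha => ha₃.2 a (by
      simp [Cmd.block, Cmd.WritesArr, ha])
    have e12 : s₃.reg 12 = 2 := (wr₃ 12 (by omega)).trans hr₂.r12
    have e13 : s₃.reg 13 = 2 + m := (wr₃ 13 (by omega)).trans hr₂.r13
    have e14 : s₃.reg 14 = 4 + 2 * m + 4 * L := (wr₃ 14 (by omega)).trans hr₂.r14
    have e15 : s₃.reg 15 = 4 + 2 * m + 4 * L + n := (wr₃ 15 (by omega)).trans hr₂.r15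
    have e20 : s₃.reg 20 = p := (wr₃ 20 (by omega)).trans h20
    have e30 : s₃.reg 30 = r := (wr₃ 30 (by omega)).trans h30
    have e32 : s₃.reg 32 = t := (wr₃ 32 (by omega)).trans h32
    have e0 : s₃.arr 0 = w := (wa₃ 0 (by omega)).trans h0₂
    refine (Run.seq (run_markNode (a := 8) (f := 12) (g := 14) (by omega) (by omega)
      (by omega) (by omega)) (k₂ := 13) fun s₄ hs₄ ha₄ => ?_).mono le_rfl fun _ h => h
    have wr₄ : ∀ r, r < 22 ∨ 25 < r → s₄.reg r = s₃.reg r := fun r hr => ha₄.1 r (by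
      simp [markNode, Cmd.block, Cmd.WritesReg]; omega)
    have wa₄ : ∀ a, a ≠ 8 → s₄.arr a = s₃.arr a := fun a ha => ha₄.2 a (by
      simp [markNode, Cmd.block, Cmd.WritesArr, ha])
    refine (run_markNode (a := 9) (f := 13) (g := 15) (by omega)
      (by rw [wr₄ _ (by omega), wr₄ _ (by omega)]; omega)
      (by rw [wr₄ _ (by omega), wr₄ _ (by omega)]; omega)
      (by rw [wr₄ _ (by omega), wr₄ _ (by omega)]; omega)).frame.mono le_rfl fun s₅ hs₅ => ?_
    obtain ⟨hs₅, ha₅⟩ := hs₅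
    have wa₅ : ∀ a, a ≠ 9 → s₅.arr a = s₄.arr a := fun a ha => ha₅.2 a (by
      simp [markNode, Cmd.block, Cmd.WritesArr, ha])
    have f34 : s₅.reg 34 = node n p r t := by
      rw [ha₅.1 34 (by simp [markNode, Cmd.block, Cmd.WritesReg]), wr₄ 34 (by omega), hs₃.1]
    simp only [wr₄ 34 (by omega), wr₄ 13 (by omega), wr₄ 15 (by omega), wr₄ 20 (by omega),
      wr₄ 30 (by omega), wr₄ 32 (by omega), wa₄ 0 (by omega), wa₄ 9 (by omega), wa₃ 9 (by omega),
      hs₃.1, e13, e15, e20, e30, e32, e0] at hs₅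
    simp only [hs₃.1, e12, e14, e20, e30, e32, e0, wa₃ 8 (by omega)] at hs₄
    have h8 : s₅.arr 8 = s₄.arr 8 := wa₅ 8 (by omega)
    have h10 : s₅.arr 10 = Function.update (s₂.arr 10) (node n p r t) (node n p r t) := by
      rw [wa₅ 10 (by omega), wa₄ 10 (by omega), hs₃.2]
    have hv : node n p r t = (p * n + r) * n + t + 1 := rfl
    refine ⟨f34, ?_, ?_, ?_⟩
    · rw [hs₅ 0, h8, hs₄ 0, h10, Function.update_of_ne (by omega), if_neg (by omega),
        if_neg (by omega)]
      exact hzero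
    · intro v hlt
      rw [hs₅ v, h8, hs₄ v, if_neg (by omega), if_neg (by omega)]
      exact hfresh v (by omega)
    · intro p' hp' r' hr' t' ht' hle
      rw [hs₅, h8, hs₄, h10]
      by_cases he : node n p' r' t' = node n p r t
      · obtain ⟨rfl, rfl, rfl⟩ := triple_inj hr' ht' hr ht (Nat.succ_injective he)
        have hf := hfresh (node n p' r' t') (by omega)
        simp only [true_and, Function.update_self, and_true, hf]
      · simp only [he, false_and, if_false, Function.update_of_ne he]
        exact hpos p' hp' r' hr' t' ht' (by omega)
  · rintro s' ⟨-, h1, -, h2⟩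
    exact ⟨h1, fun p hp r hr t ht => h2 p hp r hr t ht (node_le hp hr ht)⟩

end RAM

namespace RAM

open DFS Relation

variable {B m L n k : ℕ} {w : ℕ → ℕ} {s : State}

/-! ### The decision program -/

theorem Edges.lt (hw : Input B m L n k w) (hmv : Moves m L n k w s) (h : Edges m L n k w s) {e : ℕ}
    (h1 : 1 ≤ e) (h2 : e ≤ L * (n + k) * (n + k)) :
    s.arr 4 e < m * n * n + 1 ∧ s.arr 5 e < m * n * n + 1 ∧ s.arr 6 e < m * n * n + 1 := by
  obtain ⟨c, rfl⟩ := Nat.exists_eq_add_of_le' h1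
  obtain ⟨t, ht, i, hi, j, hj, rfl⟩ := exists_triple (show c < L * (n + k) * (n + k) by omega)
  have he := h t ht i hi j hj
  unfold EdgeAt at he
  split_ifs at he with h1 h2
  all_goals
    have hu := node_le (hw.src t ht) (hmv.lt hw hi).1 (hmv.lt hw hj).1
    have hv := node_le (hw.tgt t ht) (hmv.lt hw hi).2 (hmv.lt hw hj).2
    refine ⟨?_, ?_, ?_⟩ <;> omega

theorem Nodes.arr10 (h : Nodes m L n w s) {v : ℕ} (hv : v < m * n * n + 1) : s.arr 10 v = v := by
  rcases v with _ | c
  · exact h.zero.2.2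
  · obtain ⟨p, hp, r, hr, t, ht, rfl⟩ := exists_triple (show c < m * n * n by omega)
    exact (h.pos p hp r hr t ht).2.2

theorem Nodes.lt (h : Nodes m L n w s) {v : ℕ} (hv : v < m * n * n + 1) :
    s.arr 8 v < m * n * n + 1 ∧ s.arr 9 v < m * n * n + 1 := by
  rcases v with _ | c
  · rw [h.zero.1, h.zero.2.1]
    omega
  · obtain ⟨p, hp, r, hr, t, ht, rfl⟩ := exists_triple (show c < m * n * n by omega)
    have h2 := h.pos p hp r hr t ht
    unfold node at h2
    rw [h2.1, h2.2.1]
    constructor <;> split_ifs <;> omega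

/-- Test whether edge `reg 20 + 1` has empty input and nonempty output, starts at a useful node and
has both ends in the same strongly connected component. If so, set register `35` to `1`. -/
def checkEdge : Cmd := .block
  [.add 22 20 1, .load 23 7 22, .ite 23 (.block [.load 24 4 22, .load 25 20 24,
    .ite 25 (.block [.load 25 30 24, .ite 25 (.block [.load 25 6 22, .load 26 50 24, .load 27 50 25,
      .sub 28 26 27, .ite 28 .skip (.block [.sub 28 27 26, .ite 28 .skip (.move 35 1)])])
    .skip]) .skip]) .skip]

/-- The condition that `checkEdge` tests. -/
def Bad (s : State) (e : ℕ) : Prop :=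
  s.arr 7 e ≠ 0 ∧ s.arr 20 (s.arr 4 e) ≠ 0 ∧ s.arr 30 (s.arr 4 e) ≠ 0 ∧
    s.arr 50 (s.arr 4 e) = s.arr 50 (s.arr 6 e)

theorem run_checkEdge {e : ℕ} (h1 : s.reg 1 = 1) (h20 : s.reg 20 = e) (he : e + 1 < B) :
    Run B checkEdge s 25 fun s' =>
      (Bad s (e + 1) → s'.reg 35 = 1) ∧ (¬ Bad s (e + 1) → s'.reg 35 = s.reg 35) := by
  refine (Run.of_wp (R := fun s' => (Bad s (e + 1) → s'.reg 35 = 1) ∧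
    (¬ Bad s (e + 1) → s'.reg 35 = s.reg 35)) ?_).mono
    (by simp [checkEdge, Cmd.block, Cmd.cost]) fun s' h => h
  by_cases c1 : s.arr 7 (e + 1) = 0
  · simp [checkEdge, Cmd.block, wp, h1, h20, he, Bad, c1]
  by_cases c2 : s.arr 20 (s.arr 4 (e + 1)) = 0
  · simp [checkEdge, Cmd.block, wp, h1, h20, he, Bad, c1, c2]
  by_cases c3 : s.arr 30 (s.arr 4 (e + 1)) = 0
  · simp [checkEdge, Cmd.block, wp, h1, h20, he, Bad, c1, c2, c3]
  rcases lt_trichotomy (s.arr 50 (s.arr 4 (e + 1))) (s.arr 50 (s.arr 6 (e + 1))) with c | c | c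
  · simp [checkEdge, Cmd.block, wp, h1, h20, he, Bad, c1, c2, c3, c.ne, c.le]
    omega
  · simp [checkEdge, Cmd.block, wp, h1, h20, he, Bad, c1, c2, c3, c]
  · simp [checkEdge, Cmd.block, wp, h1, h20, he, Bad, c1, c2, c3, c.ne', c.le]
    omega

/-- Test all edges and compute the answer. -/
def answer : Cmd := .seq (.const 35 0) (.seq (.forLoop 20 11 21 checkEdge) (.sub 0 1 35))

open Classical in
theorem run_answer (hr : Regs m L n k s) (hB : L * (n + k) * (n + k) + 1 < B) :
    Run B answer s (29 * (L * (n + k) * (n + k)) + 5) fun s' => s'.reg 0 =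
      if ∃ e, 1 ≤ e ∧ e ≤ L * (n + k) * (n + k) ∧ Bad s e then 0 else 1 := by
  have hinit : Run B (.const 35 0) s 1 fun s₁ => s₁.reg 35 = 0 := Run.of_wp (by simp [wp]; omega)
  refine (Run.seq hinit (k₂ := L * (n + k) * (n + k) * (25 + 4) + 3 + 1) fun s₁ hs₁ ha₁ => ?_).mono
    (by omega) fun _ h => h
  have hr₁ : Regs m L n k s₁ := hr.congr fun r hr => ha₁.1 r (by simp [Cmd.WritesReg]; omega)
  have ha₁' : ∀ a, s₁.arr a = s.arr a := fun a => ha₁.2 a (by simp [Cmd.WritesArr])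
  refine Run.seq (Run.forLoop (k := 25) (fun c s' => s'.reg 35 =
    if ∃ e, 1 ≤ e ∧ e ≤ c ∧ Bad s e then 1 else 0) (by decide) (by decide) (by decide)
    (by simp [checkEdge, Cmd.block, Cmd.WritesReg]) (by simp [checkEdge, Cmd.block, Cmd.WritesReg])
    hr₁.r11 hB (fun c s' v w h => by simpa using h) ?_ ?_) fun s₂ hs₂ ha₂ => Run.of_wp ?_
  · rw [if_neg (by rintro ⟨e, h1, h2, -⟩; omega)]
    exact hs₁
  · rintro c hc s₂ hs₂ ha₂ h20
    have h1 : s₂.reg 1 = 1 := (ha₂.1 1 (by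
      simp [Cmd.forLoop, checkEdge, Cmd.block, Cmd.WritesReg])).trans hr₁.r1
    have ha₂' : s₂.arr = s.arr := funext fun a => (ha₂.2 a (by
      simp [Cmd.forLoop, checkEdge, Cmd.block, Cmd.WritesArr])).trans (ha₁' a)
    have hbad : ∀ e, Bad s₂ e ↔ Bad s e := fun e => by simp only [Bad, ha₂']
    refine (run_checkEdge h1 h20 (by omega)).mono le_rfl fun s₃ hs₃ => ?_
    rw [hbad] at hs₃
    by_cases hb : Bad s (c + 1)
    · rw [if_pos ⟨c + 1, by omega, le_rfl, hb⟩]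
      exact hs₃.1 hb
    · rw [hs₃.2 hb, hs₂]
      congr 1
      refine propext ⟨fun ⟨e, h1, h2, h3⟩ => ⟨e, h1, by omega, h3⟩, fun ⟨e, h1, h2, h3⟩ =>
        ⟨e, h1, ?_, h3⟩⟩
      by_contra hlt
      obtain rfl : e = c + 1 := by omega
      exact hb h3
  · have h1 : s₂.reg 1 = 1 := (ha₂.1 1 (by
      simp [Cmd.forLoop, checkEdge, Cmd.block, Cmd.WritesReg])).trans hr₁.r1
    simp only [wp, State.setReg_reg, Function.update_self, h1, hs₂]
    split_ifs <;> rfl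

/-- The decision program: build the product graph, find the nodes that are reachable from initial
nodes and those that reach final nodes, compute the strongly connected components for the edges with
empty input, and inspect all edges. -/
def decisionProgram : Cmd := .seq setup <| .seq listMoves <| .seq listEdges <| .seq listNodes <|
  .seq (search 4 5 8 20) <| .seq (search 5 4 9 30) <| .seq (search 4 6 10 40) <|
  .seq (search 6 4 41 50) answer

/-- In terms of the listed product graph: some edge with empty input and nonempty output starts at
a useful node and lies on a cycle of edges with empty input. -/
def Violation (m L n k : ℕ) (s : State) : Prop :=
  ∃ e, 1 ≤ e ∧ e ≤ L * (n + k) * (n + k) ∧ s.arr 7 e ≠ 0 ∧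
    (∃ v < m * n * n + 1,
      ReflTransGen (Edge (L * (n + k) * (n + k)) (s.arr 4) (s.arr 5)) (s.arr 8 v) (s.arr 4 e)) ∧
    (∃ v < m * n * n + 1,
      ReflTransGen (Edge (L * (n + k) * (n + k)) (s.arr 4) (s.arr 5)) (s.arr 4 e) (s.arr 9 v)) ∧
    ReflTransGen (Edge (L * (n + k) * (n + k)) (s.arr 4) (s.arr 6)) (s.arr 6 e) (s.arr 4 e)

theorem Agree.regs {P : Cmd} {s' : State} (hr : Regs m L n k s) (h : Agree P s s')
    (hP : ∀ r < 20, ¬ P.WritesReg r) : Regs m L n k s' :=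
  hr.congr fun r hr => h.1 r (hP r hr)

theorem search_writesReg {S G R b r : ℕ} (hr : r < 20) : ¬ (search S G R b).WritesReg r := by
  simp [search, buildLinks, dfsStep, visit, Cmd.forLoop, Cmd.block, Cmd.WritesReg]
  omega

theorem search_writesArr {S G R b a : ℕ} (h : a < b ∨ b + 5 ≤ a) :
    ¬ (search S G R b).WritesArr a := by
  simp [search, buildLinks, dfsStep, visit, Cmd.forLoop, Cmd.block, Cmd.WritesArr]
  omega

theorem _root_.DFS.Result.length_eq {K M : ℕ} {S G R L : ℕ → ℕ} {post : List ℕ}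
    (h : Result K M S G R L post) (hR : ∀ j < K, R j = j) : post.length = K := by
  rw [← List.toFinset_card_of_nodup h.nodup, ← Finset.card_range K]
  congr 1
  ext v
  rw [List.mem_toFinset, Finset.mem_range, ← h.vis]
  refine ⟨h.lt v, fun hv => ?_⟩
  have := h.root v hv
  rw [hR v hv] at this
  omega

open Classical in
theorem run_decisionProgram (hw : Input B m L n k w) (hr : ∀ r, s.reg r = 0) (h0 : s.arr 0 = w)
    (hz : ∀ a, a ≠ 0 → s.arr a = fun _ => 0) :
    Run B decisionProgram s (2000 * ((m + L) * (n + k) ^ 2)) fun s' => ∃ s₀, Moves m L n k w s₀ ∧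
      Edges m L n k w s₀ ∧ Nodes m L n w s₀ ∧
      s'.reg 0 = if Violation m L n k s₀ then 0 else 1 := by
  have hb := hw.bound
  have hm := hw.m_pos
  have hn := hw.n_pos
  set a := n + k with ha
  set K := m * n * n + 1 with hK
  set M := L * a * a with hM
  have hZ : 22 + (15 * a + 6) + 100 * ((L * a + L) * a + L + 1) + 100 * ((m * n + m) * n + m + 1) +
      4 * (60 * (K + M + 1)) + (29 * M + 5) ≤ 2000 * ((m + L) * a ^ 2) := by
    have ha0 : 0 < a := by omega
    have i1 : m * n * n ≤ m * a * a := by gcongr <;> omega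
    have i2 : m * n ≤ m * n * n := Nat.le_mul_of_pos_right _ hn
    have i3 : m ≤ m * n := Nat.le_mul_of_pos_right _ hn
    have i4 : L * a ≤ L * a * a := Nat.le_mul_of_pos_right _ ha0
    have i5 : L ≤ L * a := Nat.le_mul_of_pos_right _ ha0
    have i6 : a ≤ m * a * a := (Nat.le_mul_of_pos_left a hm).trans (Nat.le_mul_of_pos_right _ ha0)
    have e1 : (m + L) * a ^ 2 = m * a * a + L * a * a := by ring
    have e2 : (L * a + L) * a = L * a * a + L * a := by ring
    have e3 : (m * n + m) * n = m * n * n + m * n := by ring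
    omega
  refine Run.mono (k₁ := 22 + ((15 * a + 6) + (100 * ((L * a + L) * a + L + 1) +
    (100 * ((m * n + m) * n + m + 1) + (60 * (K + M + 1) + (60 * (K + M + 1) + (60 * (K + M + 1) +
    (60 * (K + M + 1) + (29 * M + 5))))))))) ?_ (by omega) (fun _ h => h)
  refine Run.seq (run_setup hw hr h0) fun s₁ hr₁ ha₁ => ?_
  have wa₁ : ∀ x, s₁.arr x = s.arr x := fun x => ha₁.2 x (by
    simp [setup, Cmd.block, Cmd.WritesArr])
  refine Run.seq (run_listMoves hw hr₁ ((wa₁ 0).trans h0) ((wa₁ 2).trans (hz 2 (by omega))))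
    fun s₂ hmv₂ ha₂ => ?_
  have hr₂ := ha₂.regs hr₁ fun r hr => by
    simp [listMoves, Cmd.forLoop, Cmd.block, Cmd.WritesReg]; omega
  have wa₂ : ∀ x, x = 0 ∨ 4 ≤ x → s₂.arr x = s.arr x := fun x hx => (ha₂.2 x (by
    simp [listMoves, Cmd.forLoop, Cmd.block, Cmd.WritesArr]; omega)).trans (wa₁ x)
  refine Run.seq (run_listEdges hw hr₂ ((wa₂ 0 (by omega)).trans h0) hmv₂ fun x hx =>
    (wa₂ x (by omega)).trans (hz x (by omega))) fun s₃ hed₃ ha₃ => ?_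
  have hr₃ := ha₃.regs hr₂ fun r hr => by
    simp [listEdges, Cmd.forLoop₃, Cmd.forLoop, Cmd.block, Cmd.WritesReg]; omega
  have wa₃ : ∀ x, x < 4 ∨ 8 ≤ x → s₃.arr x = s₂.arr x := fun x hx => ha₃.2 x (by
    simp [listEdges, Cmd.forLoop₃, Cmd.forLoop, Cmd.block, Cmd.WritesArr]; omega)
  refine Run.seq (run_listNodes hw hr₃ ((wa₃ 0 (by omega)).trans ((wa₂ 0 (by omega)).trans h0))
    fun x hx => (wa₃ x (by omega)).trans ((wa₂ x (by omega)).trans (hz x (by omega))))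
    fun s₄ hnd₄ ha₄ => ?_
  have hr₄ := ha₄.regs hr₃ fun r hr => by
    simp [listNodes, Cmd.forLoop₃, Cmd.forLoop, markNode, Cmd.block, Cmd.WritesReg]; omega
  have wa₄ : ∀ x, x < 8 ∨ 11 ≤ x → s₄.arr x = s₃.arr x := fun x hx => ha₄.2 x (by
    simp [listNodes, Cmd.forLoop₃, Cmd.forLoop, markNode, Cmd.block, Cmd.WritesArr]; omega)
  have hz₄ : ∀ x, 11 ≤ x → s₄.arr x = fun _ => 0 := fun x hx => by
    rw [wa₄ x (by omega), wa₃ x (by omega), wa₂ x (by omega), hz x (by omega)]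
  have hmv₄ : Moves m L n k w s₄ := by
    constructor <;> simpa only [wa₄ 1 (by omega), wa₄ 2 (by omega), wa₄ 3 (by omega),
      wa₃ 1 (by omega), wa₃ 2 (by omega), wa₃ 3 (by omega)] using by
        first | exact hmv₂.eps | exact hmv₂.sym
  have hed₄ : Edges m L n k w s₄ := fun t ht i hi j hj =>
    (hed₃ t ht i hi j hj).congr (fun x hx => wa₄ x (by omega)) fun x hx => by
      rw [wa₄ x (by omega)]
  have hlt := fun e h1 h2 => hed₄.lt hw hmv₄ (e := e) h1 h2
  refine Run.seq (run_search (S := 4) (G := 5) (R := 8) (b := 20) (K := K) (M := M) (by omega)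
    (by omega) (by omega) (by omega) hr₄.r1 hr₄.r10 hr₄.r11 (fun x hx _ => hz₄ x (by omega))
    (fun e h1 h2 => (hlt e h1 h2).2.1) fun v hv => (hnd₄.lt hv).1) fun s₅ hs₅ ha₅ => ?_
  have hr₅ := ha₅.regs hr₄ fun r => search_writesReg
  have wa₅ : ∀ x, x < 20 ∨ 25 ≤ x → s₅.arr x = s₄.arr x := fun x hx =>
    ha₅.2 x (search_writesArr hx)
  refine Run.seq (run_search (S := 5) (G := 4) (R := 9) (b := 30) (K := K) (M := M) (by omega)
    (by omega) (by omega) (by omega) hr₅.r1 hr₅.r10 hr₅.r11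
    (fun x hx _ => by rw [wa₅ x (by omega), hz₄ x (by omega)])
    (fun e h1 h2 => by rw [wa₅ 4 (by omega)]; exact (hlt e h1 h2).1)
    fun v hv => by rw [wa₅ 9 (by omega)]; exact (hnd₄.lt hv).2) fun s₆ hs₆ ha₆ => ?_
  have hr₆ := ha₆.regs hr₅ fun r => search_writesReg
  have wa₆ : ∀ x, x < 30 ∨ 35 ≤ x → s₆.arr x = s₅.arr x := fun x hx =>
    ha₆.2 x (search_writesArr hx)
  have wb₆ : ∀ x, x < 20 ∨ 35 ≤ x → s₆.arr x = s₄.arr x := fun x hx =>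
    (wa₆ x (by omega)).trans (wa₅ x (by omega))
  refine Run.seq (run_search (S := 4) (G := 6) (R := 10) (b := 40) (K := K) (M := M) (by omega)
    (by omega) (by omega) (by omega) hr₆.r1 hr₆.r10 hr₆.r11
    (fun x hx _ => by rw [wb₆ x (by omega), hz₄ x (by omega)])
    (fun e h1 h2 => by rw [wb₆ 6 (by omega)]; exact (hlt e h1 h2).2.2)
    fun v hv => by rw [wb₆ 10 (by omega), hnd₄.arr10 hv]; exact hv) fun s₇ hs₇ ha₇ => ?_
  have hr₇ := ha₇.regs hr₆ fun r => search_writesReg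
  have wa₇ : ∀ x, x < 40 ∨ 45 ≤ x → s₇.arr x = s₆.arr x := fun x hx =>
    ha₇.2 x (search_writesArr hx)
  have wb₇ : ∀ x, x < 20 ∨ 45 ≤ x → s₇.arr x = s₄.arr x := fun x hx =>
    (wa₇ x (by omega)).trans (wb₆ x (by omega))
  obtain ⟨post₅, hs₅, -⟩ := hs₅
  obtain ⟨post₆, hs₆, -⟩ := hs₆
  obtain ⟨post₇, hs₇, hp₇⟩ := hs₇
  rw [wa₅ 5 (by omega), wa₅ 4 (by omega), wa₅ 9 (by omega)] at hs₆
  rw [wb₆ 4 (by omega), wb₆ 6 (by omega), wb₆ 10 (by omega)] at hs₇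
  have hlen := hs₇.length_eq fun v hv => hnd₄.arr10 hv
  have hroots : ∀ j < K, s₇.arr 41 j < K := fun j hj => by
    obtain ⟨l₁, l₂, hl, -⟩ := hp₇.exists_split (j := j) (by omega)
    exact hs₇.lt _ ((hs₇.vis _).2 (by rw [hl]; simp))
  refine Run.seq (run_search (S := 6) (G := 4) (R := 41) (b := 50) (K := K) (M := M) (by omega)
    (by omega) (by omega) (by omega) hr₇.r1 hr₇.r10 hr₇.r11
    (fun x hx _ => by rw [wb₇ x (by omega), hz₄ x (by omega)])
    (fun e h1 h2 => by rw [wb₇ 4 (by omega)]; exact (hlt e h1 h2).1) hroots) fun s₈ hs₈ ha₈ => ?_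
  have hr₈ := ha₈.regs hr₇ fun r => search_writesReg
  have wa₈ : ∀ x, x < 50 ∨ 55 ≤ x → s₈.arr x = s₇.arr x := fun x hx =>
    ha₈.2 x (search_writesArr hx)
  obtain ⟨post₈, hs₈, -⟩ := hs₈
  rw [wb₇ 6 (by omega), wb₇ 4 (by omega)] at hs₈
  refine (run_answer hr₈ (show M + 1 < B by omega)).mono le_rfl fun s₉ hs₉ => ⟨s₄, hmv₄, hed₄, hnd₄, ?_⟩
  rw [hs₉]
  congr 1
  refine propext (exists_congr fun e => and_congr_right fun h1 => and_congr_right fun h2 => ?_)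
  obtain ⟨hS, -, hZ⟩ := hlt e h1 h2
  have e4 : s₈.arr 4 = s₄.arr 4 := (wa₈ 4 (by omega)).trans (wb₇ 4 (by omega))
  have e6 : s₈.arr 6 = s₄.arr 6 := (wa₈ 6 (by omega)).trans (wb₇ 6 (by omega))
  have e7 : s₈.arr 7 = s₄.arr 7 := (wa₈ 7 (by omega)).trans (wb₇ 7 (by omega))
  have e20 : s₈.arr 20 = s₅.arr 20 :=
    (wa₈ 20 (by omega)).trans ((wa₇ 20 (by omega)).trans (wa₆ 20 (by omega)))
  have e30 : s₈.arr 30 = s₆.arr 30 := (wa₈ 30 (by omega)).trans (wa₇ 30 (by omega))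
  rw [Bad, e4, e6, e7, e20, e30, hs₅.ne_zero_iff, hs₆.ne_zero_iff,
    hs₇.kosaraju hp₇ hlen hs₈ hS hZ]
  simp only [reach_swap (S := s₄.arr 4)]
  have hedge : Edge M (s₄.arr 4) (s₄.arr 6) (s₄.arr 4 e) (s₄.arr 6 e) := ⟨e, h1, h2, rfl, rfl⟩
  have hone : ReflTransGen (Edge M (s₄.arr 4) (s₄.arr 6)) (s₄.arr 4 e) (s₄.arr 6 e) :=
    .single hedge
  simp only [hone, true_and]
  exact Iff.rfl

end RAM

/-! ### The encoding of the input -/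

theorem labelCode_injective {σ : ℕ} : Function.Injective (labelCode (σ := σ)) := by
  rintro (_ | a) (_ | b) h <;> simp_all [labelCode, Fin.ext_iff]

theorem labelCode_eq_zero {σ : ℕ} {x : Option (Fin σ)} : labelCode x = 0 ↔ x = none := by
  cases x <;> simp [labelCode]

theorem length_flags {n : ℕ} (s : Set (Fin n)) : (flags s).length = n := by simp [flags]

theorem getD_flags_ne_zero {n : ℕ} (s : Set (Fin n)) (i : Fin n) :
    (flags s).getD i 0 ≠ 0 ↔ i ∈ s := by
  simp [flags, List.getD_eq_getElem?_getD]

theorem IsListing.ncard_eq {β : Type*} {l : List β} {s : Set β} (h : IsListing l s) :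
    s.ncard = l.length := by
  classical
  have : s = (l.toFinset : Set β) := by
    ext e
    simp [h.2]
  rw [this, Set.ncard_coe_finset, List.toFinset_card_of_nodup h.1]

theorem List.getD_append_add {β : Type*} (l₁ l₂ : List β) {n : ℕ} (h : l₁.length = n) (i : ℕ)
    (d : β) : (l₁ ++ l₂).getD (n + i) d = l₂.getD i d := by
  subst h
  rw [List.getD_append_right _ _ _ _ (Nat.le_add_right _ _), Nat.add_sub_cancel_left]

theorem List.getD_flatMap_append {β : Type*} {c : ℕ} {f : β → List ℕ} (hf : ∀ e, (f e).length = c)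
    (l : List β) (rest : List ℕ) {t : ℕ} (ht : t < l.length) {j : ℕ} (hj : j < c) :
    (l.flatMap f ++ rest).getD (c * t + j) 0 = (f l[t]).getD j 0 := by
  induction l generalizing t with
  | nil => simp at ht
  | cons e l ih =>
    rw [List.flatMap_cons, List.append_assoc]
    cases t with
    | zero =>
      rw [Nat.mul_zero, Nat.zero_add, List.getD_append _ _ _ _ (by rw [hf]; exact hj)]
      rfl
    | succ t =>
      rw [show c * (t + 1) + j = c + (c * t + j) by ring, List.getD_append_add _ _ (hf e)]
      exact ih (by simpa using ht)

/-- The parts of an input word for a transducer or an automaton. -/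
theorem getD_code {β : Type*} {n c : ℕ} {l : List β} {f : β → List ℕ} {f₁ f₂ rest : List ℕ}
    (hf : ∀ e, (f e).length = c) (h₁ : f₁.length = n) (h₂ : f₂.length = n) {w : List ℕ}
    (hw : w = [n, l.length] ++ f₁ ++ f₂ ++ l.flatMap f ++ rest) :
    w.getD 0 0 = n ∧ w.getD 1 0 = l.length ∧ (∀ i < n, w.getD (2 + i) 0 = f₁.getD i 0) ∧
    (∀ i < n, w.getD (2 + n + i) 0 = f₂.getD i 0) ∧
    (∀ t, ∀ ht : t < l.length, ∀ j < c, w.getD (2 + 2 * n + c * t + j) 0 = (f l[t]).getD j 0) ∧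
    ∀ i, w.getD (2 + 2 * n + c * l.length + i) 0 = rest.getD i 0 := by
  subst hw
  simp only [List.append_assoc]
  have e1 : ∀ i, 2 + n + i = 2 + (n + i) := fun i => by ring
  have e2 : ∀ t j, 2 + 2 * n + c * t + j = 2 + (n + (n + (c * t + j))) := fun t j => by ring
  have hlen : [n, l.length].length = 2 := rfl
  refine ⟨rfl, rfl, fun i hi => ?_, fun i hi => ?_, fun t ht j hj => ?_, fun i => ?_⟩
  · rw [List.getD_append_add _ _ hlen, List.getD_append _ _ _ _ (by omega)]
  · rw [e1, List.getD_append_add _ _ hlen, List.getD_append_add _ _ h₁,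
      List.getD_append _ _ _ _ (by omega)]
  · rw [e2, List.getD_append_add _ _ hlen, List.getD_append_add _ _ h₁,
      List.getD_append_add _ _ h₂, List.getD_flatMap_append hf _ _ ht hj]
  · rw [e2, List.getD_append_add _ _ hlen, List.getD_append_add _ _ h₁,
      List.getD_append_add _ _ h₂, List.getD_append_add]
    simp [List.length_flatMap, hf, mul_comm]

open RAM DFS Relation

section Semantics

variable {σ m n : ℕ} {T : Transducer (Fin σ) (Fin m)} {A : NFA (Fin σ) (Fin n)}
  {l : List (Fin m × Option (Fin σ) × Option (Fin σ) × Fin m)}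
  {k : List (Fin n × Fin σ × Fin n)}

/-- The input word contains the transducer and the automaton. -/
structure Encodes (T : Transducer (Fin σ) (Fin m)) (A : NFA (Fin σ) (Fin n))
    (l : List (Fin m × Option (Fin σ) × Option (Fin σ) × Fin m))
    (k : List (Fin n × Fin σ × Fin n)) (w : ℕ → ℕ) : Prop where
  w0 : w 0 = m
  w1 : w 1 = l.length
  wn : w (2 + 2 * m + 4 * l.length) = n
  wk : w (3 + 2 * m + 4 * l.length) = k.length
  start : ∀ p : Fin m, w (2 + p) ≠ 0 ↔ p ∈ T.start
  accept : ∀ p : Fin m, w (2 + m + p) ≠ 0 ↔ p ∈ T.accept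
  edge : ∀ t, ∀ ht : t < l.length, w (2 + 2 * m + 4 * t) = l[t].1 ∧
    w (2 + 2 * m + 4 * t + 1) = labelCode l[t].2.1 ∧
    w (2 + 2 * m + 4 * t + 2) = labelCode l[t].2.2.1 ∧ w (2 + 2 * m + 4 * t + 3) = l[t].2.2.2
  start' : ∀ r : Fin n, w (4 + 2 * m + 4 * l.length + r) ≠ 0 ↔ r ∈ A.start
  accept' : ∀ r : Fin n, w (4 + 2 * m + 4 * l.length + n + r) ≠ 0 ↔ r ∈ A.accept
  move : ∀ i, ∀ hi : i < k.length, w (4 + 2 * m + 4 * l.length + 2 * n + 3 * i) = k[i].1 ∧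
    w (4 + 2 * m + 4 * l.length + 2 * n + 3 * i + 1) = labelCode (some k[i].2.1) ∧
    w (4 + 2 * m + 4 * l.length + 2 * n + 3 * i + 2) = k[i].2.2

theorem encodes_code (T : Transducer (Fin σ) (Fin m)) (A : NFA (Fin σ) (Fin n))
    (l : List (Fin m × Option (Fin σ) × Option (Fin σ) × Fin m))
    (k : List (Fin n × Fin σ × Fin n)) :
    Encodes T A l k fun i => (T.code l ++ A.code k).getD i 0 := by
  obtain ⟨h1, h2, h3, h4, h5, h6⟩ := getD_code (w := T.code l ++ A.code k) (c := 4)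
    (fun e => rfl) (length_flags T.start) (length_flags T.accept) rfl
  obtain ⟨g1, g2, g3, g4, g5, -⟩ := getD_code (w := A.code k) (c := 3) (rest := [])
    (fun e => rfl) (length_flags A.start) (length_flags A.accept) (List.append_nil _).symm
  have at_add : ∀ i j, i = 2 + 2 * m + 4 * l.length + j →
      (T.code l ++ A.code k).getD i 0 = (A.code k).getD j 0 := fun i j h => h ▸ h6 j
  constructor
  · exact h1
  · exact h2
  · exact (at_add _ 0 rfl).trans g1
  · exact (at_add _ 1 (by ring)).trans g2
  · intro p
    rw [h3 p p.2]
    exact getD_flags_ne_zero _ p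
  · intro p
    rw [h4 p p.2]
    exact getD_flags_ne_zero _ p
  · intro t ht
    exact ⟨h5 t ht 0 (by omega), h5 t ht 1 (by omega), h5 t ht 2 (by omega), h5 t ht 3 (by omega)⟩
  · intro r
    rw [at_add _ (2 + r) (by ring), g3 r r.2]
    exact getD_flags_ne_zero _ r
  · intro r
    rw [at_add _ (2 + n + r) (by ring), g4 r r.2]
    exact getD_flags_ne_zero _ r
  · intro i hi
    refine ⟨?_, ?_, ?_⟩
    · exact (at_add _ (2 + 2 * n + 3 * i + 0) (by ring)).trans (g5 i hi 0 (by omega))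
    · exact (at_add _ (2 + 2 * n + 3 * i + 1) (by ring)).trans (g5 i hi 1 (by omega))
    · exact (at_add _ (2 + 2 * n + 3 * i + 2) (by ring)).trans (g5 i hi 2 (by omega))

variable {w : ℕ → ℕ}

theorem Encodes.input (h : Encodes T A l k w) (hm : 0 < m) (hn : 0 < n) {B : ℕ}
    (hB : 2 * (m * n * n + 1) + l.length * (n + k.length) * (n + k.length) +
      (2 * m + 4 * l.length + 2 * n + 3 * k.length) + 20 < B) :
    Input B m l.length n k.length w where
  m_pos := hm
  n_pos := hn
  w0 := h.w0
  w1 := h.w1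
  wn := h.wn
  wk := h.wk
  src t ht := by rw [(h.edge t ht).1]; exact Fin.is_lt _
  tgt t ht := by rw [(h.edge t ht).2.2.2]; exact Fin.is_lt _
  moveSrc i hi := by rw [(h.move i hi).1]; exact Fin.is_lt _
  moveTgt i hi := by rw [(h.move i hi).2.2]; exact Fin.is_lt _
  bound := hB

/-! ### The listed graph is the product -/

/-- The number of a state of the product transducer. -/
def code (a : (Fin m × Fin n) × Fin n) : ℕ := node n a.1.1 a.1.2 a.2

theorem code_injective : Function.Injective (code (m := m) (n := n)) := by
  rintro ⟨⟨p, r⟩, s⟩ ⟨⟨p', r'⟩, s'⟩ h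
  obtain ⟨h1, h2, h3⟩ := triple_inj r.2 s.2 r'.2 s'.2 (Nat.succ_injective h)
  exact Prod.ext (Prod.ext (Fin.ext h1) (Fin.ext h2)) (Fin.ext h3)

theorem code_pos (a : (Fin m × Fin n) × Fin n) : 0 < code a := Nat.succ_pos _

theorem code_lt (a : (Fin m × Fin n) × Fin n) : code a < m * n * n + 1 :=
  Nat.lt_succ_of_le (node_le a.1.1.2 a.1.2.2 a.2.2)

variable {s : State}

theorem Encodes.optStep_of_move (h : Encodes T A l k w) (hk : IsListing k A.transitions)
    (hmv : Moves m l.length n k.length w s) {i : ℕ} (hi : i < n + k.length) :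
    ∃ r x r', A.OptStep r x r' ∧ s.arr 1 i = r ∧ s.arr 2 i = labelCode x ∧ s.arr 3 i = r' := by
  by_cases hin : i < n
  · exact ⟨⟨i, hin⟩, none, ⟨i, hin⟩, rfl, hmv.eps i hin⟩
  · obtain ⟨j, rfl⟩ := Nat.exists_eq_add_of_le (not_lt.1 hin)
    have hj : j < k.length := by omega
    obtain ⟨h1, h2, h3⟩ := hmv.sym j hj
    obtain ⟨g1, g2, g3⟩ := h.move j hj
    exact ⟨k[j].1, some k[j].2.1, k[j].2.2, (hk.2 _).1 (List.getElem_mem hj), h1.trans g1,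
      h2.trans g2, h3.trans g3⟩

theorem Encodes.exists_move (h : Encodes T A l k w) (hk : IsListing k A.transitions)
    (hmv : Moves m l.length n k.length w s) {r r' : Fin n} {x : Option (Fin σ)}
    (hr : A.OptStep r x r') :
    ∃ i < n + k.length, s.arr 1 i = r ∧ s.arr 2 i = labelCode x ∧ s.arr 3 i = r' := by
  cases x with
  | none =>
    obtain rfl : r' = r := hr
    exact ⟨r', by omega, hmv.eps r' r'.2⟩
  | some a =>
    obtain ⟨j, hj, he⟩ := List.getElem_of_mem ((hk.2 (r, a, r')).2 hr)
    obtain ⟨h1, h2, h3⟩ := hmv.sym j hj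
    obtain ⟨g1, g2, g3⟩ := h.move j hj
    rw [he] at g1 g2 g3
    exact ⟨n + j, by omega, h1.trans g1, h2.trans g2, h3.trans g3⟩

/-- The entries of the arrays `4`, `5`, `6` and `7` at `e` are those of the transition
`(a, x, y, b)` of the product. -/
def EdgeCode (s : State) (e : ℕ) (a b : (Fin m × Fin n) × Fin n) (x y : Option (Fin σ)) : Prop :=
  s.arr 4 e = code a ∧ s.arr 5 e = code b ∧ s.arr 6 e = (if x = none then code b else code a) ∧
    s.arr 7 e = if x = none then labelCode y else 0

/-- Every transition of the product is listed. -/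
theorem Encodes.exists_edge (h : Encodes T A l k w) (hl : IsListing l T.edges)
    (hk : IsListing k A.transitions) (hmv : Moves m l.length n k.length w s)
    (hed : Edges m l.length n k.length w s) {a b : (Fin m × Fin n) × Fin n}
    {x y : Option (Fin σ)} (he : (a, x, y, b) ∈ ((T.restrictInput A).restrictOutput A).edges) :
    ∃ e, 1 ≤ e ∧ e ≤ l.length * (n + k.length) * (n + k.length) ∧ EdgeCode s e a b x y := by
  obtain ⟨⟨hT, hx⟩, hy⟩ := he
  obtain ⟨t, ht, hlt⟩ := List.getElem_of_mem ((hl.2 _).2 hT)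
  obtain ⟨i, hi, hi1, hi2, hi3⟩ := h.exists_move hk hmv hx
  obtain ⟨j, hj, hj1, hj2, hj3⟩ := h.exists_move hk hmv hy
  obtain ⟨h1, h2, h3, h4⟩ := h.edge t ht
  rw [hlt] at h1 h2 h3 h4
  have hE := hed t ht i hi j hj
  rw [EdgeAt, if_pos ⟨h2.trans hi2.symm, h3.trans hj2.symm⟩] at hE
  obtain ⟨e4, e5, e6, e7⟩ := hE
  rw [h1, hi1, hj1] at e4
  rw [h4, hi3, hj3] at e5
  rw [h2, e4, e5] at e6
  rw [h2, h3] at e7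
  simp only [labelCode_eq_zero] at e6 e7
  exact ⟨_, Nat.le_add_left 1 _, triple_lt ht hi hj, e4, e5, e6, e7⟩

/-- Every listed edge is a loop at the dummy node or comes from a transition of the product. -/
theorem Encodes.edge_cases (h : Encodes T A l k w) (hl : IsListing l T.edges)
    (hk : IsListing k A.transitions) (hmv : Moves m l.length n k.length w s)
    (hed : Edges m l.length n k.length w s) {e : ℕ} (h1 : 1 ≤ e)
    (h2 : e ≤ l.length * (n + k.length) * (n + k.length)) :
    (s.arr 4 e = 0 ∧ s.arr 5 e = 0 ∧ s.arr 6 e = 0 ∧ s.arr 7 e = 0) ∨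
    ∃ a b x y, (a, x, y, b) ∈ ((T.restrictInput A).restrictOutput A).edges ∧
      EdgeCode s e a b x y := by
  obtain ⟨c, rfl⟩ := Nat.exists_eq_add_of_le' h1
  obtain ⟨t, ht, i, hi, j, hj, rfl⟩ := exists_triple (Nat.lt_of_succ_le h2)
  have hE := hed t ht i hi j hj
  by_cases hc : w (2 + 2 * m + 4 * t + 1) = s.arr 2 i ∧ w (2 + 2 * m + 4 * t + 2) = s.arr 2 j
  · rw [EdgeAt, if_pos hc] at hE
    obtain ⟨r, x, r', hx, hi1, hi2, hi3⟩ := h.optStep_of_move hk hmv hi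
    obtain ⟨u, y, u', hy, hj1, hj2, hj3⟩ := h.optStep_of_move hk hmv hj
    obtain ⟨g1, g2, g3, g4⟩ := h.edge t ht
    obtain rfl : l[t].2.1 = x := labelCode_injective (by rw [← g2, ← hi2]; exact hc.1)
    obtain rfl : l[t].2.2.1 = y := labelCode_injective (by rw [← g3, ← hj2]; exact hc.2)
    obtain ⟨e4, e5, e6, e7⟩ := hE
    rw [g1, hi1, hj1] at e4
    rw [g4, hi3, hj3] at e5
    rw [g2, e4, e5] at e6
    rw [g2, g3] at e7
    simp only [labelCode_eq_zero] at e6 e7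
    exact .inr ⟨((l[t].1, r), u), ((l[t].2.2.2, r'), u'), _, _,
      ⟨⟨(hl.2 _).1 (List.getElem_mem ht), hx⟩, hy⟩, e4, e5, e6, e7⟩
  · rw [EdgeAt, if_neg hc] at hE
    exact .inl hE

theorem reflTransGen_map_iff {β : Type*} {R : ℕ → ℕ → Prop} {S : β → β → Prop} {f : β → ℕ}
    (h₁ : ∀ a v, R (f a) v → ∃ b, v = f b ∧ ReflTransGen S a b)
    (h₂ : ∀ a b, S a b → R (f a) (f b)) {a : β} {v : ℕ} :
    ReflTransGen R (f a) v ↔ ∃ b, v = f b ∧ ReflTransGen S a b := by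
  constructor
  · intro h
    induction h with
    | refl => exact ⟨a, rfl, .refl⟩
    | tail _ h ih =>
      obtain ⟨b, rfl, hb⟩ := ih
      obtain ⟨c, hc, hbc⟩ := h₁ b _ h
      exact ⟨c, hc, hb.trans hbc⟩
  · rintro ⟨b, rfl, h⟩
    exact h.lift f h₂

theorem Encodes.reach_iff (h : Encodes T A l k w) (hl : IsListing l T.edges)
    (hk : IsListing k A.transitions) (hmv : Moves m l.length n k.length w s)
    (hed : Edges m l.length n k.length w s) {a : (Fin m × Fin n) × Fin n} {v : ℕ} :
    ReflTransGen (Edge (l.length * (n + k.length) * (n + k.length)) (s.arr 4) (s.arr 5))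
      (code a) v ↔
    ∃ b, v = code b ∧ ReflTransGen ((T.restrictInput A).restrictOutput A).Step a b := by
  refine reflTransGen_map_iff ?_ ?_
  · rintro a _ ⟨e, h1, h2, h4, rfl⟩
    rcases h.edge_cases hl hk hmv hed h1 h2 with hz | ⟨a', b, x, y, he, hc⟩
    · have := code_pos a
      omega
    · obtain rfl : a' = a := code_injective (hc.1.symm.trans h4)
      exact ⟨b, hc.2.1, .single ⟨x, y, he⟩⟩
  · rintro a b ⟨x, y, he⟩
    obtain ⟨e, h1, h2, hc⟩ := h.exists_edge hl hk hmv hed he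
    exact ⟨e, h1, h2, hc.1, hc.2.1⟩

theorem Encodes.eps_reach_iff (h : Encodes T A l k w) (hl : IsListing l T.edges)
    (hk : IsListing k A.transitions) (hmv : Moves m l.length n k.length w s)
    (hed : Edges m l.length n k.length w s) {a : (Fin m × Fin n) × Fin n} {v : ℕ} :
    ReflTransGen (Edge (l.length * (n + k.length) * (n + k.length)) (s.arr 4) (s.arr 6))
      (code a) v ↔
    ∃ b, v = code b ∧ ReflTransGen ((T.restrictInput A).restrictOutput A).EpsStep a b := by
  refine reflTransGen_map_iff ?_ ?_
  · rintro a _ ⟨e, h1, h2, h4, rfl⟩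
    rcases h.edge_cases hl hk hmv hed h1 h2 with hz | ⟨a', b, x, y, he, hc⟩
    · have := code_pos a
      omega
    · obtain rfl : a' = a := code_injective (hc.1.symm.trans h4)
      by_cases hx : x = none
      · subst hx
        exact ⟨b, by simpa using hc.2.2.1, .single ⟨y, he⟩⟩
      · exact ⟨a', by simpa [hx] using hc.2.2.1, .refl⟩
  · rintro a b ⟨y, he⟩
    obtain ⟨e, h1, h2, hc⟩ := h.exists_edge hl hk hmv hed he
    exact ⟨e, h1, h2, hc.1, by simpa using hc.2.2.1⟩

/-- The dummy node reaches only itself. -/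
theorem Encodes.reach_zero (h : Encodes T A l k w) (hl : IsListing l T.edges)
    (hk : IsListing k A.transitions) (hmv : Moves m l.length n k.length w s)
    (hed : Edges m l.length n k.length w s) {v : ℕ}
    (hv : ReflTransGen (Edge (l.length * (n + k.length) * (n + k.length)) (s.arr 4) (s.arr 5))
      0 v) : v = 0 := by
  induction hv with
  | refl => rfl
  | tail _ hE ih =>
    subst ih
    obtain ⟨e, h1, h2, h4, rfl⟩ := hE
    rcases h.edge_cases hl hk hmv hed h1 h2 with hz | ⟨a', b, x, y, he, hc⟩
    · exact hz.2.1
    · have := code_pos a'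
      have := hc.1
      omega

theorem Encodes.root_cases (h : Encodes T A l k w) (hnd : Nodes m l.length n w s) {v : ℕ}
    (hv : v < m * n * n + 1) :
    (s.arr 8 v = 0 ∨ ∃ a ∈ ((T.restrictInput A).restrictOutput A).start, s.arr 8 v = code a) ∧
    (s.arr 9 v = 0 ∨ ∃ a ∈ ((T.restrictInput A).restrictOutput A).accept, s.arr 9 v = code a) := by
  rcases v with _ | c
  · exact ⟨.inl hnd.zero.1, .inl hnd.zero.2.1⟩
  · obtain ⟨p, hp, r, hr, t, ht, rfl⟩ := exists_triple (show c < m * n * n by omega)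
    obtain ⟨h8, h9, -⟩ := hnd.pos p hp r hr t ht
    constructor
    · split_ifs at h8 with hc
      · exact .inr ⟨((⟨p, hp⟩, ⟨r, hr⟩), ⟨t, ht⟩), ⟨⟨(h.start ⟨p, hp⟩).1 hc.1,
          (h.start' ⟨r, hr⟩).1 hc.2.1⟩, (h.start' ⟨t, ht⟩).1 hc.2.2⟩, h8⟩
      · exact .inl h8
    · split_ifs at h9 with hc
      · exact .inr ⟨((⟨p, hp⟩, ⟨r, hr⟩), ⟨t, ht⟩), ⟨⟨(h.accept ⟨p, hp⟩).1 hc.1,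
          (h.accept' ⟨r, hr⟩).1 hc.2.1⟩, (h.accept' ⟨t, ht⟩).1 hc.2.2⟩, h9⟩
      · exact .inl h9

theorem Encodes.arr_start (h : Encodes T A l k w) (hnd : Nodes m l.length n w s)
    {a : (Fin m × Fin n) × Fin n} (ha : a ∈ ((T.restrictInput A).restrictOutput A).start) :
    s.arr 8 (code a) = code a := by
  refine (hnd.pos _ a.1.1.2 _ a.1.2.2 _ a.2.2).1.trans (if_pos ?_)
  exact ⟨(h.start _).2 ha.1.1, (h.start' _).2 ha.1.2, (h.start' _).2 ha.2⟩

theorem Encodes.arr_accept (h : Encodes T A l k w) (hnd : Nodes m l.length n w s)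
    {a : (Fin m × Fin n) × Fin n} (ha : a ∈ ((T.restrictInput A).restrictOutput A).accept) :
    s.arr 9 (code a) = code a := by
  refine (hnd.pos _ a.1.1.2 _ a.1.2.2 _ a.2.2).2.1.trans (if_pos ?_)
  exact ⟨(h.accept _).2 ha.1.1, (h.accept' _).2 ha.1.2, (h.accept' _).2 ha.2⟩

theorem Encodes.violation_iff (h : Encodes T A l k w) (hl : IsListing l T.edges)
    (hk : IsListing k A.transitions) (hmv : Moves m l.length n k.length w s)
    (hed : Edges m l.length n k.length w s) (hnd : Nodes m l.length n w s) :
    Violation m l.length n k.length s ↔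
      ((T.restrictInput A).restrictOutput A).trim.HasProperEpsCycle := by
  rw [Transducer.trim_hasProperEpsCycle_iff]
  constructor
  · rintro ⟨e, h1, h2, h7, ⟨v, hv, hreach⟩, ⟨v', hv', hreach'⟩, hcyc⟩
    obtain hz | ⟨a, b, x, y, he, e4, e5, e6, e7⟩ := h.edge_cases hl hk hmv hed h1 h2
    · exact absurd hz.2.2.2 h7
    obtain rfl : x = none := by
      by_contra hx
      rw [if_neg hx] at e7
      exact h7 e7
    rw [if_pos rfl] at e6 e7
    obtain ⟨y, rfl⟩ : ∃ z, y = some z := Option.ne_none_iff_exists'.1 fun hy =>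
      h7 (e7.trans (labelCode_eq_zero.2 hy))
    rw [e4] at hreach hreach' hcyc
    rw [e6] at hcyc
    refine ⟨a, b, y, he, ⟨?_, ?_⟩, ?_⟩
    · rcases (h.root_cases hnd hv).1 with hz | ⟨i, hi, hvi⟩
      · rw [hz] at hreach
        have := h.reach_zero hl hk hmv hed hreach
        have := code_pos a
        omega
      · rw [hvi, h.reach_iff hl hk hmv hed] at hreach
        obtain ⟨a', ha', hia⟩ := hreach
        obtain rfl := code_injective ha'
        exact ⟨i, hi, Transducer.exists_path_iff.2 hia⟩
    · obtain ⟨f, hf, haf⟩ := (h.reach_iff hl hk hmv hed).1 hreach'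
      rcases (h.root_cases hnd hv').2 with hz | ⟨f', hf', hvf⟩
      · have := code_pos f
        omega
      · obtain rfl : f = f' := code_injective (hf.symm.trans hvf)
        exact ⟨f, hf', Transducer.exists_path_iff.2 haf⟩
    · obtain ⟨a', ha', hba⟩ := (h.eps_reach_iff hl hk hmv hed).1 hcyc
      obtain rfl := code_injective ha'
      exact hba
  · rintro ⟨a, b, y, he, ⟨⟨i, hi, hia⟩, f, hf, haf⟩, hba⟩
    obtain ⟨e, h1, h2, e4, e5, e6, e7⟩ := h.exists_edge hl hk hmv hed he
    rw [if_pos rfl] at e6 e7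
    refine ⟨e, h1, h2, ?_, ⟨code i, code_lt i, ?_⟩, ⟨code f, code_lt f, ?_⟩, ?_⟩
    · rw [e7]
      exact Nat.succ_ne_zero _
    · rw [h.arr_start hnd hi, e4, h.reach_iff hl hk hmv hed]
      exact ⟨a, rfl, Transducer.exists_path_iff.1 hia⟩
    · rw [h.arr_accept hnd hf, e4, h.reach_iff hl hk hmv hed]
      exact ⟨f, rfl, Transducer.exists_path_iff.1 haf⟩
    · rw [e6, e4, h.eps_reach_iff hl hk hmv hed]
      exact ⟨a, rfl, hba⟩

end Semantics

/-- The numbers that occur are at most cubic in the total size `Z ≥ 2`, and `32 Z³ ≤ Z⁸`. The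
exponent is `2000` because one constant serves for the words and for the time. -/
theorem word_bound {m n L k : ℕ} (hm : 0 < m) (hn : 0 < n) :
    2 * (m * n * n + 1) + L * (n + k) * (n + k) + (2 * m + 4 * L + 2 * n + 3 * k) + 20 <
      (m + L + (n + k)) ^ 2000 := by
  set Z := m + L + (n + k) with hZ
  have hZ2 : 2 ≤ Z := by omega
  have h1 : m * n * n ≤ Z * Z * Z := by gcongr <;> omega
  have h2 : L * (n + k) * (n + k) ≤ Z * Z * Z := by gcongr <;> omega
  have h3 : Z ≤ Z * Z * Z := by
    rw [mul_assoc]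
    exact Nat.le_mul_of_pos_right _ (by positivity)
  have h4 : Z ^ 8 ≤ Z ^ 2000 := pow_le_pow_right₀ (by omega) (by norm_num)
  have h5 : 32 * (Z * Z * Z) ≤ Z ^ 8 := by
    have : 2 ^ 5 ≤ Z ^ 5 := Nat.pow_le_pow_left hZ2 5
    calc 32 * (Z * Z * Z) ≤ Z ^ 5 * (Z * Z * Z) := Nat.mul_le_mul_right _ this
      _ = Z ^ 8 := by ring
  refine lt_of_lt_of_le ?_ h4
  clear h4
  omega

theorem decidesFinMarginal_decisionProgram (σ : ℕ) :
    DecidesFinMarginal σ RAM.decisionProgram 2000 := by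
  intro m n hm hn T A l k hl hk
  have hT : T.size = m + l.length := by simp [Transducer.size, hl.ncard_eq]
  have hA : A.size = n + k.length := by simp [NFA.size, hk.ncard_eq]
  have henc := encodes_code T A l k
  rw [hT, hA]
  obtain ⟨t, s, hex, ht, s₀, hmv, hed, hnd, hs⟩ := run_decisionProgram
    (s := RAM.initial (T.code l ++ A.code k)) (henc.input hm hn (word_bound hm hn)) (fun _ => rfl)
    rfl fun a ha => by simp [RAM.initial, ha]
  refine ⟨t, s, hex, ht, ?_⟩
  rw [hs, Transducer.finMarginal_iff, henc.violation_iff hl hk hmv hed hnd]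
  by_cases hc : ((T.restrictInput A).restrictOutput A).trim.HasProperEpsCycle <;> simp [hc]

/-- For every fixed alphabet `Fin σ`: (1) `L(A)` is finitely marginal with respect to `T` iff the
trim part of `T ↓ A ↑ A` has no proper ε-input cycle, and (2) there is a program that decides this
property, for given `T` and `A`, in time `O(|T| |A|²)`. -/
theorem theorem5 (σ : ℕ) :
    (∀ (m n : ℕ) (T : Transducer (Fin σ) (Fin m)) (A : NFA (Fin σ) (Fin n)),
      T.FinMarginal A.accepts ↔
        ¬ ((T.restrictInput A).restrictOutput A).trim.HasProperEpsCycle) ∧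
    (∃ (P : RAM.Cmd) (C : ℕ), DecidesFinMarginal σ P C) :=
  ⟨fun _ _ _ A => Transducer.finMarginal_iff A, RAM.decisionProgram, 2000,
    decidesFinMarginal_decisionProgram σ⟩
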